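/- Let $X,Y,Z$ be random variables on finite alphabets $\mathcal X,\mathcal Y,\mathcal Z$ with joint law $P_{X,Y,Z}$, and let $\Delta\in\mathbb R$. Alice, Bob and Eve observe $X^n,Y^n,Z^n$, where $(X_i,Y_i,Z_i)$ are i.i.d. with law $P_{X,Y,Z}$. An interactive protocol of blocklength $n$ consists of public messages $F_1,\dots,F_r$ on finite alphabets, where $F_i\sim P_{F_i|X^n,F_{1:i-1}}$ for odd $i$ (sent by Alice) and $F_i\sim P_{F_i|Y^n,F_{1:i-1}}$ for even $i$ (sent by Bob), followed by keys $K_A\sim P_{K_A|X^n,F_{1:r}}$ and $K_B\sim P_{K_B|Y^n,F_{1:r}}$ on a finite alphabet $\mathcal K$. It is an $(n,R,\delta)$ code, with $R=\frac1nH(K_A)$, if $$\mathbb P[K_A=K_B]\ge 1-\delta,\qquad R\ge \tfrac1n\log|\mathcal K|-\delta,\qquad \tfrac1n I(K_A;Z^n,F_{1:r})\le\delta .$$ Let $S_\Delta(X;Y\|Z)$ be the supremum ($-\infty$ if there is none) of all real $R$ such that for every $\delta>0$ and every $N$ there is an $(n,R',\delta)$ code with $n\ge N$, $R'\ge R-\delta$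 and $\frac1nH(Z^n|F_{1:r})\ge\Delta-\delta$; that is, the supremum of key rates of protocols with $\lim_{n\to\infty}\frac1nH(Z^n|F_{1:r})\ge\Delta$. Then $$S_\Delta(X;Y\|Z)\le\Psi_\Delta(X;Y\|Z):=\inf_J\ \max_{(U,V)}\ \bigl[I(X;Y|J)+I(U;J|V)-I(U;Z|V)\bigr],$$ where the infimum is over all $P_{J|X,Y,Z}$ with $J$ on a finite alphabet, and the maximum (equal to $-\infty$ if there is no admissible pair) is over all finite-alphabet $(U,V)$ such that $(U,V)-(X,Y)-(J,Z)$ is a Markov chain, $$I(V;Z)\le I(V;J)+H(Z)-\Delta,$$ $|\mathcal V|\le|\mathcal X||\mathcal Y|+1$ and $|\mathcal U|\le|\mathcal X||\mathcal Y|$. For every $J$, if some finite-alphabet pair $(U,V)$ satisfies the Markov chain and the constraint, then the inner maximum is attained, and it equals the supremum taken without the cardinality bounds. Moreover, if $Z=f(X,Y)$ almost surely for some function $f:\mathcal X\times\mathcal Y\to\mathcal Z$, then adding the requirement $H(X,Y|U,V,Z)=0$ to the inner maximization does not change the value of $\Psi_\Delta$; indeed, for every $J$ for which a feasible pair exists,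 the inner maximum is attained by a pair $(U,V)$ that satisfies both the cardinality bounds and $H(X,Y|U,V,Z)=0$. -/

import Mathlib

open scoped BigOperators

namespace KeyAgreement

noncomputable section

/-! ### Shannon quantities of finite-valued random variables (natural logarithm) -/

section Shannon

variable {Ω α β γ : Type*} [Fintype Ω] [Fintype α] [Fintype β] [Fintype γ]

open Classical in
/-- Probability that the random variable `A` takes the value `a`, when the sample point
has probability mass function `p`. -/
def prob (p : Ω → ℝ) (A : Ω → α) (a : α) : ℝ :=
  ∑ ω, if A ω = a then p ω else 0

/-- Entropy `H(A) = -∑ P(a) log P(a)`, with `0 log 0 = 0`. -/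
def entropy (p : Ω → ℝ) (A : Ω → α) : ℝ :=
  ∑ a, Real.negMulLog (prob p A a)

/-- Conditional entropy `H(A|B)`. -/
def condEntropy (p : Ω → ℝ) (A : Ω → α) (B : Ω → β) : ℝ :=
  entropy p (fun ω => (A ω, B ω)) - entropy p B

/-- Mutual information `I(A;B)`. -/
def mutualInfo (p : Ω → ℝ) (A : Ω → α) (B : Ω → β) : ℝ :=
  entropy p A - condEntropy p A B

/-- Conditional mutual information `I(A;B|C)`. -/
def condMutualInfo (p : Ω → ℝ) (A : Ω → α) (B : Ω → β) (C : Ω → γ) : ℝ :=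
  condEntropy p A C - condEntropy p A (fun ω => (B ω, C ω))

end Shannon

/-- A probability mass function on a finite alphabet. -/
abbrev Law (α : Type*) [Fintype α] : Type _ := stdSimplex ℝ α

/-- A conditional probability mass function `P_{B|A}` between finite alphabets. -/
abbrev Channel (α β : Type*) [Fintype β] : Type _ := α → Law β

/-! ### Interactive key-agreement protocols -/

/-- An interactive protocol of blocklength `n`. Rounds are numbered `0, 1, …, rounds - 1`; Alice
sends the public message in the even rounds (the first, third, … message) and Bob in the odd ones.
Each message is drawn, with fresh randomness, from a conditional law given the sender's source
sequence and all earlier messages; finally each party draws a key from a conditional law given its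
own source sequence and the whole transcript. -/
structure Protocol (𝒳 𝒴 : Type*) (n : ℕ) where
  /-- number of rounds -/
  rounds : ℕ
  /-- size of the (common) message alphabet -/
  msgs : ℕ
  /-- size of the (common) key alphabet -/
  keys : ℕ
  /-- Alice's message in round `i`, used for even `i` -/
  aliceMsg : (i : ℕ) → Channel ((Fin n → 𝒳) × (Fin i → Fin msgs)) (Fin msgs)
  /-- Bob's message in round `i`, used for odd `i` -/
  bobMsg : (i : ℕ) → Channel ((Fin n → 𝒴) × (Fin i → Fin msgs)) (Fin msgs)
  aliceKey : Channel ((Fin n → 𝒳) × (Fin rounds → Fin msgs)) (Fin keys)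
  bobKey : Channel ((Fin n → 𝒴) × (Fin rounds → Fin msgs)) (Fin keys)

namespace Protocol

variable {𝒳 𝒴 𝒵 : Type*} {n : ℕ}

/-- Public transcripts `F_{1:r}`. -/
abbrev Transcript (c : Protocol 𝒳 𝒴 n) : Type := Fin c.rounds → Fin c.msgs

/-- The messages sent before round `i`. -/
def past (c : Protocol 𝒳 𝒴 n) (f : c.Transcript) (i : Fin c.rounds) : Fin i.val → Fin c.msgs :=
  fun j => f (Fin.castLE i.isLt.le j)

/-- Conditional probability of the transcript `f` given the two source sequences. -/
def transcriptProb (c : Protocol 𝒳 𝒴 n) (x : Fin n → 𝒳) (y : Fin n → 𝒴)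
    (f : c.Transcript) : ℝ :=
  ∏ i : Fin c.rounds,
    if Even i.val then (c.aliceMsg i.val (x, c.past f i)).1 (f i)
    else (c.bobMsg i.val (y, c.past f i)).1 (f i)

/-- Values of `(X^n, Y^n, Z^n, F_{1:r}, K_A, K_B)`. -/
abbrev Outcome (c : Protocol 𝒳 𝒴 n) (𝒵 : Type*) : Type _ :=
  (Fin n → 𝒳) × (Fin n → 𝒴) × (Fin n → 𝒵) × c.Transcript × Fin c.keys × Fin c.keys

variable [Fintype 𝒳] [Fintype 𝒴] [Fintype 𝒵]

/-- The joint law of `(X^n, Y^n, Z^n, F_{1:r}, K_A, K_B)` when the source is i.i.d. from `P`. -/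
def jointLaw (c : Protocol 𝒳 𝒴 n) (P : Law (𝒳 × 𝒴 × 𝒵)) : c.Outcome 𝒵 → ℝ :=
  fun ⟨x, y, z, f, kA, kB⟩ =>
    (∏ i, P.1 (x i, y i, z i)) * c.transcriptProb x y f
      * (c.aliceKey (x, f)).1 kA * (c.bobKey (y, f)).1 kB

/-- Key rate `H(K_A) / n`. -/
def keyRate (c : Protocol 𝒳 𝒴 n) (P : Law (𝒳 × 𝒴 × 𝒵)) : ℝ :=
  entropy (c.jointLaw P) (fun ⟨_, _, _, _, kA, _⟩ => kA) / n

/-- Agreement probability `P[K_A = K_B]`. -/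
def agreement (c : Protocol 𝒳 𝒴 n) (P : Law (𝒳 × 𝒴 × 𝒵)) : ℝ :=
  prob (c.jointLaw P) (fun ⟨_, _, _, _, kA, kB⟩ => decide (kA = kB)) true

/-- Leakage rate `I(K_A; Z^n, F_{1:r}) / n`. -/
def leakage (c : Protocol 𝒳 𝒴 n) (P : Law (𝒳 × 𝒴 × 𝒵)) : ℝ :=
  mutualInfo (c.jointLaw P) (fun ⟨_, _, _, _, kA, _⟩ => kA) (fun ⟨_, _, z, f, _, _⟩ => (z, f)) / n

/-- Eve's remaining uncertainty `H(Z^n | F_{1:r}) / n` about `Z^n` given the transcript alone. -/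
def equivocation (c : Protocol 𝒳 𝒴 n) (P : Law (𝒳 × 𝒴 × 𝒵)) : ℝ :=
  condEntropy (c.jointLaw P) (fun ⟨_, _, z, _, _, _⟩ => z) (fun ⟨_, _, _, f, _, _⟩ => f) / n

/-- The protocol is an `(n, R, δ)` code with `R` its key rate: the keys agree with probability at
least `1 - δ`, the key is nearly uniform, and it is nearly independent of Eve's observations. -/
def IsCode (c : Protocol 𝒳 𝒴 n) (P : Law (𝒳 × 𝒴 × 𝒵)) (δ : ℝ) : Prop :=
  1 - δ ≤ c.agreement P ∧
  Real.log c.keys / n - δ ≤ c.keyRate P ∧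
  c.leakage P ≤ δ

end Protocol

section Source

variable {𝒳 𝒴 𝒵 : Type*} [Fintype 𝒳] [Fintype 𝒴] [Fintype 𝒵]

/-- `R` is an achievable key rate by protocols with `lim (1/n) H(Z^n | F_{1:r}) ≥ Δ`: there are
codes of arbitrarily large blocklength, with `δ` arbitrarily small, whose key rates and
equivocation rates are asymptotically at least `R` and `Δ`. -/
def Achievable (P : Law (𝒳 × 𝒴 × 𝒵)) (Δ R : ℝ) : Prop :=
  ∀ δ : ℝ, 0 < δ → ∀ N : ℕ, ∃ n : ℕ, N ≤ n ∧ 0 < n ∧ ∃ c : Protocol 𝒳 𝒴 n,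
    c.IsCode P δ ∧ R - δ ≤ c.keyRate P ∧ Δ - δ ≤ c.equivocation P

/-- `S_Δ(X;Y‖Z)`, the supremum of the achievable key rates (`-∞` if there are none). -/
def keyCapacity (P : Law (𝒳 × 𝒴 × 𝒵)) (Δ : ℝ) : EReal :=
  ⨆ (R : ℝ) (_ : Achievable P Δ R), (R : EReal)

end Source

/-! ### The single-letter bound -/

/-- An auxiliary receiver `J` on an arbitrary finite alphabet, given by `P_{J|X,Y,Z}`. -/
structure Receiver (𝒳 𝒴 𝒵 : Type*) where
  size : ℕ
  ker : Channel (𝒳 × 𝒴 × 𝒵) (Fin size)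

/-- Auxiliary random variables `(U,V)` on arbitrary finite alphabets, given by `P_{U,V|X,Y}`. -/
structure Auxiliary (𝒳 𝒴 : Type*) where
  sizeU : ℕ
  sizeV : ℕ
  ker : Channel (𝒳 × 𝒴) (Fin sizeU × Fin sizeV)

section SingleLetter

variable {𝒳 𝒴 𝒵 : Type*} [Fintype 𝒳] [Fintype 𝒴] [Fintype 𝒵]

/-- Values of `(X, Y, Z, J, U, V)`. -/
abbrev Letter (J : Receiver 𝒳 𝒴 𝒵) (W : Auxiliary 𝒳 𝒴) : Type _ :=
  𝒳 × 𝒴 × 𝒵 × Fin J.size × Fin W.sizeU × Fin W.sizeV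

/-- The joint law `P_{X,Y,Z} P_{J|X,Y,Z} P_{U,V|X,Y}` of `(X, Y, Z, J, U, V)`, i.e. the general
joint law extending that of `(X, Y, Z, J)` in which `(U,V) - (X,Y) - (J,Z)` is a Markov chain. -/
def letterLaw (P : Law (𝒳 × 𝒴 × 𝒵)) (J : Receiver 𝒳 𝒴 𝒵) (W : Auxiliary 𝒳 𝒴) :
    Letter J W → ℝ :=
  fun ⟨x, y, z, j, u, v⟩ => P.1 (x, y, z) * (J.ker (x, y, z)).1 j * (W.ker (x, y)).1 (u, v)

/-- `I(X;Y|J) + I(U;J|V) - I(U;Z|V)`. -/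
def objective (P : Law (𝒳 × 𝒴 × 𝒵)) (J : Receiver 𝒳 𝒴 𝒵) (W : Auxiliary 𝒳 𝒴) : ℝ :=
  let p := letterLaw P J W
  condMutualInfo p (fun ⟨x, _, _, _, _, _⟩ => x) (fun ⟨_, y, _, _, _, _⟩ => y)
      (fun ⟨_, _, _, j, _, _⟩ => j)
    + condMutualInfo p (fun ⟨_, _, _, _, u, _⟩ => u) (fun ⟨_, _, _, j, _, _⟩ => j)
      (fun ⟨_, _, _, _, _, v⟩ => v)
    - condMutualInfo p (fun ⟨_, _, _, _, u, _⟩ => u) (fun ⟨_, _, z, _, _, _⟩ => z)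
      (fun ⟨_, _, _, _, _, v⟩ => v)

/-- The constraint `I(V;Z) ≤ I(V;J) + H(Z) - Δ`. -/
def Feasible (P : Law (𝒳 × 𝒴 × 𝒵)) (Δ : ℝ) (J : Receiver 𝒳 𝒴 𝒵) (W : Auxiliary 𝒳 𝒴) : Prop :=
  let p := letterLaw P J W
  mutualInfo p (fun ⟨_, _, _, _, _, v⟩ => v) (fun ⟨_, _, z, _, _, _⟩ => z) ≤
    mutualInfo p (fun ⟨_, _, _, _, _, v⟩ => v) (fun ⟨_, _, _, j, _, _⟩ => j)
      + entropy p (fun ⟨_, _, z, _, _, _⟩ => z) - Δ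

/-- The cardinality bounds `|𝒰| ≤ |𝒳||𝒴|` and `|𝒱| ≤ |𝒳||𝒴| + 1`. -/
def CardBounded (W : Auxiliary 𝒳 𝒴) : Prop :=
  W.sizeU ≤ Fintype.card 𝒳 * Fintype.card 𝒴 ∧ W.sizeV ≤ Fintype.card 𝒳 * Fintype.card 𝒴 + 1

/-- The condition `H(X,Y|U,V,Z) = 0`. -/
def Determined (P : Law (𝒳 × 𝒴 × 𝒵)) (J : Receiver 𝒳 𝒴 𝒵) (W : Auxiliary 𝒳 𝒴) : Prop :=
  condEntropy (letterLaw P J W) (fun ⟨x, y, _, _, _, _⟩ => (x, y))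
    (fun ⟨_, _, z, _, u, v⟩ => (u, v, z)) = 0

/-- `Ψ_Δ(X;Y‖Z)`: infimum over `J` of the maximum of the objective over `(U,V)` subject to the
constraint and the cardinality bounds. An empty inner maximum is `-∞`. -/
def psi (P : Law (𝒳 × 𝒴 × 𝒵)) (Δ : ℝ) : EReal :=
  ⨅ J : Receiver 𝒳 𝒴 𝒵, ⨆ (W : Auxiliary 𝒳 𝒴) (_ : Feasible P Δ J W ∧ CardBounded W),
    (objective P J W : EReal)

/-- `Ψ_Δ(X;Y‖Z)` with the further restriction `H(X,Y|U,V,Z) = 0` in the inner maximum. -/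
def psiDetermined (P : Law (𝒳 × 𝒴 × 𝒵)) (Δ : ℝ) : EReal :=
  ⨅ J : Receiver 𝒳 𝒴 𝒵, ⨆ (W : Auxiliary 𝒳 𝒴)
    (_ : Feasible P Δ J W ∧ CardBounded W ∧ Determined P J W), (objective P J W : EReal)

end SingleLetter

end

end KeyAgreement

/-! Fix J and write D for an entropy of J minus the same entropy with Z in its place. Then
`objective_eq` says that the objective is I(X;Y|J) + D(V) - D(U,V), where D(V) = H(J,V) - H(Z,V) and
D(U,V) = H(J,U,V) - H(Z,U,V), and `feasible_iff` turns the constraint into D(V) ≤ H(J) - Δ. Since J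
and Z never share an entropy term, J can be treated as an alternative third source component: the
same protocol is run on the law of (X,Y,J).

Converse (`Protocol.exists_auxiliary`). Take U = K_A and V = F at blocklength n. Secrecy gives
H(K_A) ≤ H(K_A|Z^n,F) + nδ, and passing from Z^n to J^n adds exactly D(V) - D(U,V). The remaining
H(K_A|J^n,F) is at most I(K_A;K_B|J^n,F) plus a Fano term, and public discussion cannot create
conditional dependence, so this information is at most n I(X;Y|J) (`condMutualInfo_keys_le`). The
constraint comes from H(J^n,F) ≤ H(J^n) + H(F). To reach single letters, Z_i is replaced by J_i one
position at a time; D telescopes, and V acquires the position and the hybrid outputs at the other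
positions (`exists_singleLetter_kernel`).

Cardinality and attainment. D is a sum over (u,v) of a function `gap` that is homogeneous of degree
one in the unnormalized law of (X,Y) given (u,v). Shrinking the alphabets is therefore a linear
program whose basic solutions have few nonzero weights (`exists_small_kernel`). On bounded alphabets
kernels form a compact set and everything is continuous, which gives the maximum and lets δ tend to
0 (`exists_limit_auxiliary`).

If Z = f(X,Y), each measure splits into pieces with the same normalized law of Z, in each of which Z
determines (X,Y). Concavity makes the J-entropies only drop, so the objective does not decrease
(`exists_separated_split`); the shrinking step only rescales pieces and so keeps this property. -/

namespace KeyAgreement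

/-! ### Entropy inequalities on a finite sample space -/

section ShannonLemmas

set_option linter.unusedSectionVars false

variable {Ω α β γ : Type*} [Fintype Ω] [Fintype α] [Fintype β] [Fintype γ] {p : Ω → ℝ}

lemma prob_nonneg (hp : ∀ ω, 0 ≤ p ω) (A : Ω → α) (a : α) : 0 ≤ prob p A a :=
  Finset.sum_nonneg fun ω _ => by split_ifs <;> simp [hp ω]

lemma le_prob (hp : ∀ ω, 0 ≤ p ω) (A : Ω → α) (ω : Ω) : p ω ≤ prob p A (A ω) := by
  classical
  unfold prob
  refine le_trans (le_of_eq ?_) (Finset.single_le_sum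
    (f := fun ω' => if A ω' = A ω then p ω' else 0) (fun ω' _ => ?_) (Finset.mem_univ ω))
  · simp
  · show 0 ≤ ite _ _ _
    split_ifs <;> simp [hp ω']

lemma sum_prob_mul (p : Ω → ℝ) (A : Ω → α) (φ : α → ℝ) :
    ∑ a, prob p A a * φ a = ∑ ω, p ω * φ (A ω) := by
  classical
  simp only [prob, Finset.sum_mul, ite_mul, zero_mul]
  rw [Finset.sum_comm]
  refine Finset.sum_congr rfl fun ω _ => ?_
  rw [Finset.sum_eq_single (A ω)]
  · simp
  · intro b _ hb
    simp [hb.symm]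
  · simp

lemma sum_prob (p : Ω → ℝ) (A : Ω → α) : ∑ a, prob p A a = ∑ ω, p ω := by
  simpa using sum_prob_mul p A (fun _ => 1)

/-- The law of a function of `A` is computed from the law of `A`. -/
lemma prob_comp (p : Ω → ℝ) (A : Ω → α) (g : α → β) (b : β) :
    prob p (fun ω => g (A ω)) b = prob (prob p A) g b := by
  classical
  have := sum_prob_mul p A (fun a => if g a = b then 1 else 0)
  simp only [mul_ite, mul_one, mul_zero] at this
  unfold prob at this ⊢
  convert this.symm using 1

lemma sum_prob_fst (p : Ω → ℝ) (A : Ω → α) (B : Ω → β) (b : β) :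
    ∑ a, prob p (fun ω => (A ω, B ω)) (a, b) = prob p B b := by
  classical
  rw [show prob p B b = prob (prob p fun ω => (A ω, B ω)) Prod.snd b from
    prob_comp p (fun ω => (A ω, B ω)) Prod.snd b]
  unfold prob
  rw [Fintype.sum_prod_type]
  simp

/-- Sums over sample points let entropies of different variables be compared term by term; points of
mass zero contribute nothing, so junk values of the logarithm are harmless. -/
lemma entropy_eq_sum (p : Ω → ℝ) (A : Ω → α) :
    entropy p A = ∑ ω, p ω * -Real.log (prob p A (A ω)) := by
  rw [← sum_prob_mul p A (fun a => -Real.log (prob p A a))]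
  exact Finset.sum_congr rfl fun a _ => by simp [Real.negMulLog]

lemma prob_comp_injective (p : Ω → ℝ) (A : Ω → α) {g : α → β} (hg : g.Injective) (a : α) :
    prob p (fun ω => g (A ω)) (g a) = prob p A a := by
  unfold prob
  exact Finset.sum_congr rfl fun ω _ => by
    rw [show (g (A ω) = g a) = (A ω = a) from propext hg.eq_iff]

lemma entropy_comp_injective (p : Ω → ℝ) (A : Ω → α) {g : α → β} (hg : g.Injective) :
    entropy p (fun ω => g (A ω)) = entropy p A := by
  rw [entropy_eq_sum, entropy_eq_sum]
  exact Finset.sum_congr rfl fun ω _ => by rw [prob_comp_injective p A hg]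

/-- The log-sum inequality. -/
lemma log_sum_le {ι : Type*} (s : Finset ι) {f g : ι → ℝ} (hf : ∀ i, 0 ≤ f i)
    (hg : ∀ i, 0 ≤ g i) (hfg : ∀ i, f i ≠ 0 → g i ≠ 0) :
    (∑ i ∈ s, f i) * (Real.log (∑ i ∈ s, f i) - Real.log (∑ i ∈ s, g i)) ≤
      ∑ i ∈ s, f i * (Real.log (f i) - Real.log (g i)) := by
  set S := ∑ i ∈ s, f i with hS
  set T := ∑ i ∈ s, g i with hT
  have hS0 : 0 ≤ S := Finset.sum_nonneg fun i _ => hf i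
  rcases hS0.eq_or_lt with h0 | hpos
  · rw [← h0, zero_mul]
    refine le_of_eq (Finset.sum_eq_zero fun i hi => ?_).symm
    rw [(Finset.sum_eq_zero_iff_of_nonneg fun i _ => hf i).1 h0.symm i hi, zero_mul]
  obtain ⟨k, hk, hfk⟩ := Finset.exists_ne_zero_of_sum_ne_zero hpos.ne'
  have hTpos : 0 < T :=
    lt_of_lt_of_le (lt_of_le_of_ne (hg k) (hfg k hfk).symm)
      (Finset.single_le_sum (fun i _ => hg i) hk)
  -- This is 1 - 1/x ≤ log x at x = f i * T / (g i * S), multiplied by `f i`. The left-hand sides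
  -- sum to S - T * (S / T) = 0.
  have key : ∀ i ∈ s, f i - g i * (S / T) ≤
      f i * (Real.log (f i) - Real.log (g i)) - f i * (Real.log S - Real.log T) := by
    intro i _
    rcases (hf i).eq_or_lt with h | h
    · rw [← h]
      have := mul_nonneg (hg i) (div_nonneg hS0 hTpos.le)
      simpa using this
    · have hgi : 0 < g i := lt_of_le_of_ne (hg i) (hfg i h.ne').symm
      have h1 := Real.one_sub_inv_le_log_of_pos (x := f i * T / (g i * S)) (by positivity)
      rw [Real.log_div (by positivity) (by positivity), Real.log_mul h.ne' hTpos.ne',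
        Real.log_mul hgi.ne' hpos.ne', inv_div] at h1
      have h2 := mul_le_mul_of_nonneg_left h1 h.le
      have h3 : f i * (1 - g i * S / (f i * T)) = f i - g i * (S / T) := by
        field_simp
      linarith
  have hsum := Finset.sum_le_sum key
  simp only [Finset.sum_sub_distrib, ← Finset.sum_mul, ← hS, ← hT] at hsum
  have : T * (S / T) = S := by field_simp
  linarith

lemma ne_zero_of_prob_ne_zero (D : Ω → α) (k : α → ℝ) (hk : ∀ ω, p ω ≠ 0 → k (D ω) ≠ 0)
    (d : α) (hd : prob p D d ≠ 0) : k d ≠ 0 := by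
  obtain ⟨ω, -, hω⟩ := Finset.exists_ne_zero_of_sum_ne_zero hd
  by_cases e : D ω = d
  · rw [if_pos e] at hω
    exact e ▸ hk ω hω
  · simp [e] at hω

lemma prob_pos (hp : ∀ ω, 0 ≤ p ω) (D : Ω → α) {ω : Ω} (hω : p ω ≠ 0) : 0 < prob p D (D ω) :=
  lt_of_lt_of_le (lt_of_le_of_ne (hp ω) hω.symm) (le_prob hp D ω)

/-- The log-sum inequality on each fibre of `C`. The reference `k` need not be normalized: its fibre
masses remain on the left. -/
lemma sum_mul_log_le_cross (hp : ∀ ω, 0 ≤ p ω) (D : Ω → α) (C : Ω → γ) (k : α → γ → ℝ)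
    (hk : ∀ d c, 0 ≤ k d c) (hpk : ∀ ω, p ω ≠ 0 → k (D ω) (C ω) ≠ 0) :
    ∑ c, prob p C c * (Real.log (prob p C c) - Real.log (∑ d, k d c)) ≤
      ∑ ω, p ω * -Real.log (k (D ω) (C ω)) - entropy p (fun ω => (D ω, C ω)) := by
  calc _ ≤ ∑ c, ∑ d, prob p (fun ω => (D ω, C ω)) (d, c) *
        (Real.log (prob p (fun ω => (D ω, C ω)) (d, c)) - Real.log (k d c)) := by
        refine Finset.sum_le_sum fun c _ => ?_
        rw [← sum_prob_fst p D C c]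
        refine log_sum_le _ (fun d => prob_nonneg hp _ _) (fun d => hk d c) fun d hd => ?_
        exact ne_zero_of_prob_ne_zero (fun ω => (D ω, C ω)) (fun x => k x.1 x.2) hpk (d, c) hd
    _ = ∑ x : α × γ, prob p (fun ω => (D ω, C ω)) x *
        (Real.log (prob p (fun ω => (D ω, C ω)) x) - Real.log (k x.1 x.2)) := by
        rw [Fintype.sum_prod_type_right]
    _ = _ := by
        rw [sum_prob_mul, entropy_eq_sum, ← Finset.sum_sub_distrib]
        exact Finset.sum_congr rfl fun ω _ => by ring

/-- Lower bound on a cross entropy against a reference that factors conditionally on `C`. -/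
lemma entropy_add_le_cross (hp : ∀ ω, 0 ≤ p ω) (h1 : ∑ ω, p ω = 1)
    (A : Ω → α) (B : Ω → β) (C : Ω → γ) (g : α → γ → ℝ) (h : β → γ → ℝ)
    (hg : ∀ a c, 0 ≤ g a c) (hh : ∀ b c, 0 ≤ h b c)
    (hpg : ∀ ω, p ω ≠ 0 → g (A ω) (C ω) ≠ 0) (hph : ∀ ω, p ω ≠ 0 → h (B ω) (C ω) ≠ 0)
    (hgh : ∑ c, (∑ a, g a c) * ∑ b, h b c ≤ 1) :
    entropy p (fun ω => (A ω, C ω)) + entropy p (fun ω => (B ω, C ω)) - entropy p C ≤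
      ∑ ω, p ω * (-Real.log (g (A ω) (C ω)) - Real.log (h (B ω) (C ω))) := by
  -- The two fibrewise bounds leave the reference masses ∑ g and ∑ h at each c; a last log-sum
  -- inequality over c compares their product, of total mass at most 1, with the law of `C`.
  have hA := sum_mul_log_le_cross hp A C g hg hpg
  have hB := sum_mul_log_le_cross hp B C h hh hph
  have hGne : ∀ c, prob p C c ≠ 0 → (∑ a, g a c) ≠ 0 ∧ (∑ b, h b c) ≠ 0 := by
    refine fun c hc => ⟨ne_zero_of_prob_ne_zero C (fun c => ∑ a, g a c) (fun ω hω => ?_) c hc,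
      ne_zero_of_prob_ne_zero C (fun c => ∑ b, h b c) (fun ω hω => ?_) c hc⟩
    · exact (lt_of_lt_of_le (lt_of_le_of_ne (hg _ _) (hpg ω hω).symm)
        (Finset.single_le_sum (fun a _ => hg a _) (Finset.mem_univ (A ω)))).ne'
    · exact (lt_of_lt_of_le (lt_of_le_of_ne (hh _ _) (hph ω hω).symm)
        (Finset.single_le_sum (fun a _ => hh a _) (Finset.mem_univ (B ω)))).ne'
  have hG0 : ∀ c, 0 ≤ ∑ a, g a c := fun c => Finset.sum_nonneg fun a _ => hg a c
  have hH0 : ∀ c, 0 ≤ ∑ b, h b c := fun c => Finset.sum_nonneg fun b _ => hh b c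
  have hC := log_sum_le Finset.univ (f := prob p C)
    (g := fun c => (∑ a, g a c) * ∑ b, h b c) (prob_nonneg hp C)
    (fun c => mul_nonneg (hG0 c) (hH0 c))
    (fun c hc => mul_ne_zero (hGne c hc).1 (hGne c hc).2)
  rw [sum_prob, h1, Real.log_one, one_mul, zero_sub] at hC
  have hlog : Real.log (∑ c, (∑ a, g a c) * ∑ b, h b c) ≤ 0 :=
    Real.log_nonpos (Finset.sum_nonneg fun c _ => mul_nonneg (hG0 c) (hH0 c)) hgh
  have hsplit : ∑ c, prob p C c * (Real.log (prob p C c) -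
        Real.log ((∑ a, g a c) * ∑ b, h b c)) =
      ∑ c, prob p C c * (Real.log (prob p C c) - Real.log (∑ a, g a c)) +
      ∑ c, prob p C c * (Real.log (prob p C c) - Real.log (∑ b, h b c)) + entropy p C := by
    rw [entropy, ← Finset.sum_add_distrib, ← Finset.sum_add_distrib]
    refine Finset.sum_congr rfl fun c _ => ?_
    rcases eq_or_ne (prob p C c) 0 with h0 | h0
    · simp [h0]
    · rw [Real.log_mul (hGne c h0).1 (hGne c h0).2, Real.negMulLog]
      ring
  have htot : ∑ ω, p ω * (-Real.log (g (A ω) (C ω)) - Real.log (h (B ω) (C ω))) =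
      ∑ ω, p ω * -Real.log (g (A ω) (C ω)) + ∑ ω, p ω * -Real.log (h (B ω) (C ω)) := by
    rw [← Finset.sum_add_distrib]
    exact Finset.sum_congr rfl fun ω _ => by ring
  linarith

/-- Gibbs' inequality. -/
lemma entropy_le_cross (hp : ∀ ω, 0 ≤ p ω) (h1 : ∑ ω, p ω = 1) (A : Ω → α) (g : α → ℝ)
    (hg : ∀ a, 0 ≤ g a) (hpg : ∀ ω, p ω ≠ 0 → g (A ω) ≠ 0) (hsum : ∑ a, g a ≤ 1) :
    entropy p A ≤ ∑ ω, p ω * -Real.log (g (A ω)) := by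
  have hh := log_sum_le Finset.univ (f := prob p A) (g := g) (prob_nonneg hp A) hg
    (ne_zero_of_prob_ne_zero A g hpg)
  rw [sum_prob, h1, Real.log_one, one_mul, zero_sub, sum_prob_mul] at hh
  have hlog : Real.log (∑ a, g a) ≤ 0 :=
    Real.log_nonpos (Finset.sum_nonneg fun c _ => hg c) hsum
  have : ∑ ω, p ω * (Real.log (prob p A (A ω)) - Real.log (g (A ω))) =
      ∑ ω, p ω * -Real.log (g (A ω)) - entropy p A := by
    rw [entropy_eq_sum, ← Finset.sum_sub_distrib]
    exact Finset.sum_congr rfl fun ω _ => by ring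
  linarith

/-- Strong subadditivity of the entropy. -/
lemma entropy_submodular (hp : ∀ ω, 0 ≤ p ω) (h1 : ∑ ω, p ω = 1)
    (A : Ω → α) (B : Ω → β) (C : Ω → γ) :
    entropy p (fun ω => (A ω, B ω, C ω)) + entropy p C ≤
      entropy p (fun ω => (A ω, C ω)) + entropy p (fun ω => (B ω, C ω)) := by
  -- Gibbs' inequality against the law that makes A and B conditionally independent given C.
  have key := entropy_le_cross hp h1 (fun ω => (A ω, B ω, C ω))
    (fun x => prob p (fun ω => (A ω, C ω)) (x.1, x.2.2) *
      prob p (fun ω => (B ω, C ω)) (x.2.1, x.2.2) / prob p C x.2.2)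
    (fun x => div_nonneg (mul_nonneg (prob_nonneg hp _ _) (prob_nonneg hp _ _))
      (prob_nonneg hp _ _))
    (fun ω hω => (div_pos (mul_pos (prob_pos hp (fun ω => (A ω, C ω)) hω)
      (prob_pos hp (fun ω => (B ω, C ω)) hω)) (prob_pos hp C hω)).ne') (by
      refine le_of_eq ?_
      calc _ = ∑ c, ∑ a, ∑ b, prob p (fun ω => (A ω, C ω)) (a, c) *
            prob p (fun ω => (B ω, C ω)) (b, c) / prob p C c := by
            simp only [Fintype.sum_prod_type]
            rw [Finset.sum_comm]
            refine (Finset.sum_congr rfl fun b _ => Finset.sum_comm).trans ?_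
            rw [Finset.sum_comm]
            exact Finset.sum_congr rfl fun c _ => Finset.sum_comm
        _ = ∑ c, prob p C c := by
            refine Finset.sum_congr rfl fun c _ => ?_
            simp only [← Finset.sum_div, ← Finset.mul_sum, ← Finset.sum_mul, sum_prob_fst]
            rw [mul_self_div_self]
        _ = 1 := by rw [sum_prob, h1])
  have e : ∑ ω, p ω * -Real.log (prob p (fun ω => (A ω, C ω)) (A ω, C ω) *
      prob p (fun ω => (B ω, C ω)) (B ω, C ω) / prob p C (C ω)) =
      entropy p (fun ω => (A ω, C ω)) + entropy p (fun ω => (B ω, C ω)) - entropy p C := by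
    rw [entropy_eq_sum p fun ω => (A ω, C ω), entropy_eq_sum p fun ω => (B ω, C ω),
      entropy_eq_sum p C, ← Finset.sum_add_distrib, ← Finset.sum_sub_distrib]
    refine Finset.sum_congr rfl fun ω _ => ?_
    rcases eq_or_ne (p ω) 0 with h0 | h0
    · simp [h0]
    · have a1 := prob_pos hp (fun ω => (A ω, C ω)) h0
      have a2 := prob_pos hp (fun ω => (B ω, C ω)) h0
      rw [Real.log_div (mul_pos a1 a2).ne' (prob_pos hp C h0).ne', Real.log_mul a1.ne' a2.ne']
      ring
  simp only at key
  linarith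

lemma entropy_pair_le (hp : ∀ ω, 0 ≤ p ω) (h1 : ∑ ω, p ω = 1) (A : Ω → α) (B : Ω → β) :
    entropy p (fun ω => (A ω, B ω)) ≤ entropy p A + entropy p B := by
  have h := entropy_submodular hp h1 A B (fun _ => ())
  have i1 : Function.Injective (fun x : α × β => (x.1, x.2, ())) := by
    rintro ⟨a, b⟩ ⟨c, d⟩ h
    simpa using h
  have i2 : Function.Injective (fun x : α => (x, ())) := fun a b h => by simpa using h
  have i3 : Function.Injective (fun x : β => (x, ())) := fun a b h => by simpa using h
  have e1 := entropy_comp_injective p (fun ω => (A ω, B ω)) i1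
  have e2 := entropy_comp_injective p A i2
  have e3 := entropy_comp_injective p B i3
  have e4 : entropy p (fun _ => ()) = 0 := by
    have : prob p (fun _ => ()) () = 1 := by simp [prob, h1]
    simp [entropy, this]
  simp only at e1 e2 e3
  linarith

/-- Fano's inequality. -/
lemma fano (hp : ∀ ω, 0 ≤ p ω) (h1 : ∑ ω, p ω = 1) {K : ℕ} (A B : Ω → Fin K) :
    condEntropy p A B ≤ Real.log 2 +
      (1 - prob p (fun ω => decide (A ω = B ω)) true) * Real.log K := by
  classical
  have hΩ : Nonempty Ω := by
    by_contra h
    rw [not_nonempty_iff] at h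
    simp at h1
  have hK : 0 < K := Fin.pos (A hΩ.some)
  have hK' : (0 : ℝ) < K := by exact_mod_cast hK
  -- Guess for A given B = b: half the mass on b, the rest spread uniformly. Its cost is log 2, plus
  -- log K when the guess fails.
  let q : Fin K → Fin K → ℝ := fun a b => if a = b then 1 / 2 else 1 / (2 * K)
  have hq : ∀ a b, 0 < q a b := fun a b => by
    simp only [q]
    split_ifs <;> positivity
  have hqs : ∀ b, ∑ a, q a b ≤ 1 := by
    intro b
    calc ∑ a, q a b ≤ ∑ a : Fin K, ((if a = b then 1 / 2 else 0) + 1 / (2 * (K : ℝ))) := by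
          refine Finset.sum_le_sum fun a _ => ?_
          have : (0 : ℝ) ≤ 1 / (2 * K) := by positivity
          simp only [q]
          split_ifs <;> linarith
      _ = 1 := by
          rw [Finset.sum_add_distrib]
          simp
          field_simp
          norm_num
  have hpos : ∀ ω, p ω ≠ 0 → 0 < prob p B (B ω) := fun ω hω => prob_pos hp B hω
  have key := entropy_le_cross hp h1 (fun ω => (A ω, B ω)) (fun x => q x.1 x.2 * prob p B x.2)
    (fun x => mul_nonneg (hq _ _).le (prob_nonneg hp _ _))
    (fun ω hω => (mul_pos (hq _ _) (hpos ω hω)).ne') (by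
      rw [Fintype.sum_prod_type_right]
      simp only [← Finset.sum_mul]
      calc _ ≤ ∑ b, prob p B b := Finset.sum_le_sum fun b _ =>
            mul_le_of_le_one_left (prob_nonneg hp _ _) (hqs b)
        _ = 1 := by rw [sum_prob, h1])
  have e : ∑ ω, p ω * -Real.log (q (A ω) (B ω) * prob p B (B ω)) =
      entropy p B + (Real.log 2 +
        (1 - prob p (fun ω => decide (A ω = B ω)) true) * Real.log K) := by
    rw [entropy_eq_sum]
    have e1 : prob p (fun ω => decide (A ω = B ω)) true =
        ∑ ω, p ω * (if A ω = B ω then 1 else 0) := by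
      unfold prob
      exact Finset.sum_congr rfl fun ω _ => by simp
    rw [e1]
    rw [show (1 : ℝ) - ∑ ω, p ω * (if A ω = B ω then 1 else 0) =
      ∑ ω, p ω * (1 - if A ω = B ω then 1 else 0) by
        simp only [mul_sub, Finset.sum_sub_distrib, mul_one, h1]]
    have e2 : Real.log 2 = ∑ ω, p ω * Real.log 2 := by rw [← Finset.sum_mul, h1, one_mul]
    rw [e2, Finset.sum_mul, ← Finset.sum_add_distrib,
      ← Finset.sum_add_distrib]
    refine Finset.sum_congr rfl fun ω _ => ?_
    rcases eq_or_ne (p ω) 0 with h0 | h0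
    · simp [h0]
    · rw [Real.log_mul (hq _ _).ne' (hpos ω h0).ne']
      simp only [q]
      split_ifs
      · rw [one_div, Real.log_inv]
        ring
      · rw [one_div, Real.log_inv, Real.log_mul two_ne_zero hK'.ne']
        ring
  simp only at key
  unfold condEntropy
  linarith

end ShannonLemmas

/-! ### Sparse solutions of linear programs -/

section LinearProgram

variable {ι E : Type*} [AddCommGroup E] [Module ℝ E] [FiniteDimensional ℝ E]

/-- A basic solution of a linear program: the support can be shrunk to the number of equality
constraints without decreasing the linear objective `c`. -/
lemma exists_sparse_subset (x : ι → E) (c : ι → ℝ) (ℓ : E →ₗ[ℝ] ℝ) (n : ℕ) :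
    ∀ (s : Finset ι) (lam : ι → ℝ), s.card = n → (∀ i ∈ s, 0 ≤ lam i) → (∀ i ∈ s, 0 < ℓ (x i)) →
      ∃ t ⊆ s, ∃ mu : ι → ℝ, (∀ i ∈ t, 0 ≤ mu i) ∧ t.card ≤ Module.finrank ℝ E ∧
        ∑ i ∈ t, mu i • x i = ∑ i ∈ s, lam i • x i ∧
        ∑ i ∈ s, lam i * c i ≤ ∑ i ∈ t, mu i * c i := by
  classical
  induction n with
  | zero =>
    intro s lam hs h0 _
    exact ⟨s, subset_rfl, lam, h0, by omega, rfl, le_rfl⟩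
  | succ n ih =>
    intro s lam hs h0 hℓ
    by_cases hcard : s.card ≤ Module.finrank ℝ E
    · exact ⟨s, subset_rfl, lam, h0, hcard, rfl, le_rfl⟩
    have hdep : ∃ g : ι → ℝ, ∑ i ∈ s, g i • x i = 0 ∧ (∃ i ∈ s, g i ≠ 0) ∧
        0 ≤ ∑ i ∈ s, g i * c i := by
      have hnl : ¬ LinearIndependent ℝ (fun i : s => x i) := fun hl => by
        have := hl.fintype_card_le_finrank
        rw [Fintype.card_coe] at this
        exact hcard this
      obtain ⟨g, hg, i, hi⟩ := Fintype.not_linearIndependent_iff.1 hnl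
      let g' : ι → ℝ := fun i => if h : i ∈ s then g ⟨i, h⟩ else 0
      have hg' : ∑ i ∈ s, g' i • x i = 0 := by
        rw [← Finset.sum_coe_sort s (fun i => g' i • x i), ← hg]
        exact Finset.sum_congr rfl fun i _ => by simp [g']
      have hi' : g' i ≠ 0 := by simpa [g'] using hi
      rcases le_total 0 (∑ i ∈ s, g' i * c i) with h | h
      · exact ⟨g', hg', ⟨i, i.2, hi'⟩, h⟩
      · refine ⟨fun i => -g' i, by simp [hg'], ⟨i, i.2, by simpa using hi'⟩, ?_⟩
        simp only [neg_mul, Finset.sum_neg_distrib]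
        linarith
    obtain ⟨g, hgx, ⟨k, hk, hgk⟩, hgc⟩ := hdep
    -- Applying `ℓ`, positive on all the vectors, to the dependency shows that its coefficients
    -- cannot all be nonnegative.
    have hneg : (s.filter fun i => g i < 0).Nonempty := by
      by_contra hne
      rw [Finset.not_nonempty_iff_eq_empty, Finset.filter_eq_empty_iff] at hne
      have hsum : ∑ i ∈ s, g i * ℓ (x i) = 0 := by
        have := congrArg ℓ hgx
        simpa using this
      have := (Finset.sum_eq_zero_iff_of_nonneg fun i hi =>
        mul_nonneg (not_lt.1 (hne hi)) (hℓ i hi).le).1 hsum k hk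
      exact (mul_ne_zero hgk (hℓ k hk).ne') this
    -- The longest step along `g` that keeps all weights nonnegative; the weight at `m` reaches
    -- zero, and the sign of `g` was chosen so that the objective does not drop.
    obtain ⟨m, hm, hmin⟩ := Finset.exists_min_image _ (fun i => lam i / -g i) hneg
    rw [Finset.mem_filter] at hm
    set r := lam m / -g m with hr
    have hr0 : 0 ≤ r := div_nonneg (h0 m hm.1) (by linarith [hm.2])
    have hm0 : lam m + r * g m = 0 := by
      have := hm.2.ne
      rw [hr]
      field_simp
      ring
    obtain ⟨t, hts, mu, hmu, htc, htx, hto⟩ := ih (s.erase m) (fun i => lam i + r * g i)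
      (by rw [Finset.card_erase_of_mem hm.1]; omega)
      (fun i hi => by
        have his := Finset.mem_of_mem_erase hi
        rcases lt_or_ge (g i) 0 with hgi | hgi
        · have := hmin i (Finset.mem_filter.2 ⟨his, hgi⟩)
          rw [le_div_iff₀ (by linarith)] at this
          linarith
        · have := h0 i his
          positivity)
      (fun i hi => hℓ i (Finset.mem_of_mem_erase hi))
    refine ⟨t, hts.trans (Finset.erase_subset _ _), mu, hmu, htc, ?_, le_trans ?_ hto⟩
    · rw [htx, Finset.sum_erase _ (by simp [hm0])]
      simp only [add_smul, Finset.sum_add_distrib, mul_smul, ← Finset.smul_sum, hgx, smul_zero,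
        add_zero]
    · rw [Finset.sum_erase _ (by simp [hm0])]
      simp only [add_mul, Finset.sum_add_distrib, mul_assoc, ← Finset.mul_sum]
      have := mul_nonneg hr0 hgc
      linarith

/-- Pads the sparse support with zero weights to exactly `d` indices, so that the new alphabet does
not depend on the data. -/
lemma exists_sparse_family [Nonempty ι] (x : ι → E) (c : ι → ℝ) (ℓ : E →ₗ[ℝ] ℝ) (s : Finset ι)
    (lam : ι → ℝ) (h0 : ∀ i ∈ s, 0 ≤ lam i) (hℓ : ∀ i ∈ s, 0 < ℓ (x i)) {d : ℕ}
    (hd : Module.finrank ℝ E ≤ d) :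
    ∃ (e : Fin d → ι) (nu : Fin d → ℝ), (∀ k, 0 ≤ nu k) ∧
      ∑ k, nu k • x (e k) = ∑ i ∈ s, lam i • x i ∧
      ∑ i ∈ s, lam i * c i ≤ ∑ k, nu k * c (e k) := by
  classical
  obtain ⟨t, -, mu, hmu, htc, htx, hto⟩ := exists_sparse_subset x c ℓ _ s lam rfl h0 hℓ
  obtain ⟨j⟩ : Nonempty (t ↪ Fin d) := Function.Embedding.nonempty_of_card_le (by
    simpa using htc.trans hd)
  let e : Fin d → ι := Function.extend j (fun i => (i : ι)) fun _ => Classical.arbitrary ι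
  let nu : Fin d → ℝ := Function.extend j (fun i => mu i) fun _ => 0
  have he : ∀ i, e (j i) = i := fun i => j.injective.extend_apply _ _ i
  have hnu : ∀ i, nu (j i) = mu i := fun i => j.injective.extend_apply _ _ i
  have hnu0 : ∀ k, k ∉ Set.range j → nu k = 0 := fun k hk => Function.extend_apply' _ _ _ hk
  refine ⟨e, nu, fun k => ?_, ?_, ?_⟩
  · by_cases hk : k ∈ Set.range j
    · obtain ⟨i, rfl⟩ := hk
      rw [hnu]
      exact hmu i i.2
    · rw [hnu0 k hk]
  · rw [← htx, ← Finset.sum_coe_sort t]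
    refine (Fintype.sum_of_injective j j.injective _ _ (fun k hk => ?_) fun i => ?_).symm
    · simp [hnu0 k hk]
    · simp [hnu, he]
  · refine hto.trans (le_of_eq ?_)
    rw [← Finset.sum_coe_sort t]
    refine Fintype.sum_of_injective j j.injective _ _ (fun k hk => ?_) fun i => ?_
    · simp [hnu0 k hk]
    · simp [hnu, he]

end LinearProgram

/-! ### The unnormalized entropy difference -/

/-- No two points of `S` are compatible with `z` under the measure with density `w`. -/
def Separated {S ζ : Type*} (a : S → ζ → ℝ) (w : S → ℝ) : Prop :=
  ∀ z s s', w s * a s z ≠ 0 → w s' * a s' z ≠ 0 → s = s'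

lemma Separated.smul {S ζ : Type*} {a : S → ζ → ℝ} {w : S → ℝ} (h : Separated a w) (c : ℝ) : Separated a (c • w) := by
  intro z s s' h1 h2
  rw [Pi.smul_apply, smul_eq_mul, mul_assoc] at h1 h2
  exact h z s s' (right_ne_zero_of_mul h1) (right_ne_zero_of_mul h2)

section Gap

variable {S β ζ : Type*} [Fintype S] [Fintype β] [Fintype ζ]

/-- For a measure with density `w` on `S`, the entropy of the output of `b` minus the entropy of
the output of `a`, both normalized by the total mass. -/
noncomputable def gap (a : S → ζ → ℝ) (b : S → β → ℝ) (w : S → ℝ) : ℝ :=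
  ∑ j, Real.negMulLog (∑ s, w s * b s j) - ∑ z, Real.negMulLog (∑ s, w s * a s z)

variable {a : S → ζ → ℝ} {b : S → β → ℝ}

lemma gap_zero : gap a b 0 = 0 := by simp [gap]

/-- Scaling adds to each entropy sum a term total mass times `negMulLog c`; equal row sums give both
outputs the same mass, so these terms cancel. -/
lemma gap_smul (hab : ∀ s, ∑ j, b s j = ∑ z, a s z) (c : ℝ) (w : S → ℝ) :
    gap a b (c • w) = c * gap a b w := by
  have h : ∑ j, ∑ s, w s * b s j = ∑ z, ∑ s, w s * a s z := by
    rw [Finset.sum_comm, Finset.sum_comm (s := (Finset.univ : Finset ζ))]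
    simp only [← Finset.mul_sum, hab]
  simp only [gap, Pi.smul_apply, smul_eq_mul, mul_assoc, ← Finset.mul_sum, Real.negMulLog_mul,
    Finset.sum_add_distrib, ← Finset.sum_mul, h]
  ring

variable {U V : Type*} [Fintype U] [Fintype V]

/-- Unnormalized conditional laws of `(U,V)`: a conditional probability mass function given `S`. -/
def IsKernel (w : U → V → S → ℝ) : Prop :=
  (∀ u v s, 0 ≤ w u v s) ∧ ∀ s, ∑ v, ∑ u, w u v s = 1

/-- `H(J|V) - H(Z|V)`. -/
noncomputable def gapV (a : S → ζ → ℝ) (b : S → β → ℝ) (w : U → V → S → ℝ) : ℝ :=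
  ∑ v, gap a b (∑ u, w u v)

/-- `H(J|U,V) - H(Z|U,V)`. -/
noncomputable def gapUV (a : S → ζ → ℝ) (b : S → β → ℝ) (w : U → V → S → ℝ) : ℝ :=
  ∑ v, ∑ u, gap a b (w u v)

/-- Shrinking the alphabets of `U` and `V`. -/
lemma exists_small_kernel [Nonempty S] (hab : ∀ s, ∑ j, b s j = ∑ z, a s z) {w : U → V → S → ℝ}
    (hw : IsKernel w) :
    ∃ w' : Fin (Fintype.card S) → Fin (Fintype.card S + 1) → S → ℝ, IsKernel w' ∧
      gapV a b w' ≤ gapV a b w ∧ gapV a b w - gapUV a b w ≤ gapV a b w' - gapUV a b w' ∧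
      ∀ u v, ∃ u₀ v₀, ∃ c : ℝ, w' u v = c • w u₀ v₀ := by
  classical
  obtain ⟨hw0, hw1⟩ := hw
  obtain ⟨s₀⟩ := ‹Nonempty S›
  have hV : Nonempty V := by
    by_contra h
    rw [not_nonempty_iff] at h
    simpa using hw1 s₀
  have hU : Nonempty U := by
    by_contra h
    rw [not_nonempty_iff] at h
    simpa using hw1 s₀
  let tot : (S → ℝ) →ₗ[ℝ] ℝ := ∑ s, LinearMap.proj s
  have htot : ∀ x : S → ℝ, tot x = ∑ s, x s := fun x => by simp [tot]
  have hpos : ∀ x : S → ℝ, (∀ s, 0 ≤ x s) → x ≠ 0 → 0 < tot x := by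
    intro x hx hne
    rw [htot]
    obtain ⟨s, hs⟩ := Function.ne_iff.1 hne
    exact Finset.sum_pos' (fun s _ => hx s) ⟨s, Finset.mem_univ s, lt_of_le_of_ne (hx s) hs.symm⟩
  have stepU : ∀ v, ∃ (e : Fin (Fintype.card S) → U) (nu : Fin (Fintype.card S) → ℝ),
      (∀ k, 0 ≤ nu k) ∧ ∑ k, nu k • w (e k) v = ∑ u, w u v ∧
      ∑ k, gap a b (nu k • w (e k) v) ≤ ∑ u, gap a b (w u v) := by
    intro v
    -- For fixed v the |S| coordinates of ∑ u, w u v are preserved, so V and `gapV` are untouched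
    -- while `gapUV` is minimized. Zero measures are discarded, since total mass must be positive on
    -- the vectors.
    obtain ⟨e, nu, h0, hx, hc⟩ := exists_sparse_family (fun u => w u v)
      (fun u => -gap a b (w u v)) tot (Finset.univ.filter fun u => w u v ≠ 0) (fun _ => 1)
      (fun _ _ => zero_le_one) (fun u hu => hpos _ (hw0 u v) (Finset.mem_filter.1 hu).2)
      (d := Fintype.card S) (by simp)
    refine ⟨e, nu, h0, ?_, ?_⟩
    · rw [hx]
      simp only [one_smul]
      exact Finset.sum_filter_ne_zero _
    · simp only [one_mul, mul_neg, Finset.sum_neg_distrib, neg_le_neg_iff] at hc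
      simp only [gap_smul hab]
      refine hc.trans (le_of_eq ?_)
      refine Finset.sum_filter_of_ne fun u _ hu h => hu ?_
      rw [h, gap_zero]
  choose e nu hnu hsum hgap using stepU
  -- The |S| coordinates preserve normalization at every s; the extra real coordinate preserves
  -- `gapV`, hence the constraint. This is the source of the +1.
  have stepV := exists_sparse_family (E := (S → ℝ) × ℝ)
    (fun v => (∑ u, w u v, gap a b (∑ u, w u v)))
    (fun v => gap a b (∑ u, w u v) - ∑ k, gap a b (nu v k • w (e v k) v))
    (tot ∘ₗ LinearMap.fst ℝ _ _) (Finset.univ.filter fun v => ∑ u, w u v ≠ 0) (fun _ => 1)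
    (fun _ _ => zero_le_one) (fun v hv => hpos _ (fun s => by
      change 0 ≤ (∑ u, w u v) s
      rw [Finset.sum_apply]
      exact Finset.sum_nonneg fun u _ => hw0 u v s) (Finset.mem_filter.1 hv).2)
    (d := Fintype.card S + 1) (by simp)
  obtain ⟨g, mu, hmu, hx, hc⟩ := stepV
  simp only [one_smul, one_mul] at hx hc
  have hx1 := congrArg Prod.fst hx
  have hx2 := congrArg Prod.snd hx
  simp only [Prod.fst_sum, Prod.snd_sum, Prod.smul_fst, Prod.smul_snd, smul_eq_mul] at hx1 hx2
  rw [Finset.sum_filter_ne_zero (s := Finset.univ) (f := fun v => ∑ u, w u v)] at hx1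
  have hfil : ∀ F : V → ℝ, (∀ v, ∑ u, w u v = 0 → F v = 0) →
      ∑ v with ∑ u, w u v ≠ 0, F v = ∑ v, F v :=
    fun F hF => Finset.sum_filter_of_ne fun v _ hv h => hv (hF v h)
  rw [hfil _ fun v h => by rw [h, gap_zero]] at hx2
  rw [hfil] at hc
  swap
  · intro v h
    have hz : ∀ k, nu v k • w (e v k) v = 0 := by
      intro k
      have h1 := hsum v
      rw [h] at h1
      ext s
      have h2 := congrFun h1 s
      rw [Finset.sum_apply] at h2
      exact (Finset.sum_eq_zero_iff_of_nonneg fun k _ =>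
        mul_nonneg (hnu v k) (hw0 _ v s)).1 h2 k (Finset.mem_univ k)
    simp [h, hz, gap_zero]
  have hV' : ∀ l, ∑ k, mu l • nu (g l) k • w (e (g l) k) (g l) = mu l • ∑ u, w u (g l) := by
    intro l
    rw [← Finset.smul_sum, hsum]
  have hgV : gapV a b (fun k l => mu l • nu (g l) k • w (e (g l) k) (g l)) = gapV a b w := by
    unfold gapV
    rw [← hx2]
    exact Finset.sum_congr rfl fun l _ => by rw [hV', gap_smul hab]
  refine ⟨fun k l => mu l • nu (g l) k • w (e (g l) k) (g l), ⟨?_, ?_⟩, hgV.le, ?_, ?_⟩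
  · exact fun k l s => mul_nonneg (hmu l) (mul_nonneg (hnu _ k) (hw0 _ _ s))
  · intro s
    have h1 := congrFun hx1 s
    simp only [Finset.sum_apply, Pi.smul_apply] at h1
    rw [← hw1 s, ← h1]
    refine Finset.sum_congr rfl fun l _ => ?_
    have := congrFun (hV' l) s
    simpa only [Finset.sum_apply, Pi.smul_apply] using this
  · have h1 : gapUV a b w ≥ ∑ v, ∑ k, gap a b (nu v k • w (e v k) v) :=
      Finset.sum_le_sum fun v _ => hgap v
    have h2 : gapUV a b (fun k l => mu l • nu (g l) k • w (e (g l) k) (g l)) =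
        ∑ l, mu l * ∑ k, gap a b (nu (g l) k • w (e (g l) k) (g l)) := by
      unfold gapUV
      refine Finset.sum_congr rfl fun l _ => ?_
      rw [Finset.mul_sum]
      exact Finset.sum_congr rfl fun k _ => gap_smul hab _ _
    simp only [mul_sub, Finset.sum_sub_distrib] at hc
    rw [hx2] at hc
    rw [hgV, h2]
    change gapV a b w - _ ≤ gapV a b w - _ at hc
    linarith
  · exact fun k l => ⟨e (g l) k, g l, mu l * nu (g l) k, by rw [mul_smul]⟩

/-- When the values σ(z) are drawn independently from the laws `r z`, the marginal at z is `r z`: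
the indicator is absorbed into the factor at z and the other factors sum to 1. -/
lemma sum_prod_section [DecidableEq S] [DecidableEq ζ] (r : ζ → S → ℝ) (hr : ∀ z, ∑ s, r z s = 1)
    (z : ζ) (s : S) :
    ∑ σ : ζ → S, (∏ z', r z' (σ z')) * (if σ z = s then 1 else 0) = r z s := by
  have h : ∀ σ : ζ → S, (∏ z', r z' (σ z')) * (if σ z = s then 1 else 0) =
      ∏ z', r z' (σ z') * (if z' = z then (if σ z' = s then 1 else 0) else 1) := by
    intro σ
    rw [Finset.prod_mul_distrib]
    simp
  rw [Finset.sum_congr rfl fun σ _ => h σ,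
    ← Fintype.prod_sum (fun z' s' => r z' s' * (if z' = z then (if s' = s then 1 else 0) else 1)),
    Finset.prod_eq_single z]
  · simp
  · intro z' _ hz'
    simp [hz', hr]
  · simp

/-- If `Z` is a function of `S`, a measure on `S` splits into separated ones with the same law of
`Z` up to scaling. -/
lemma exists_separated_split [DecidableEq S] [DecidableEq ζ] [Nonempty S]
    (hab : ∀ s, ∑ j, b s j = ∑ z, a s z)
    (ha : ∀ s z, 0 ≤ a s z) (hb : ∀ s j, 0 ≤ b s j) (f : S → ζ) (hf : ∀ s z, a s z ≠ 0 → z = f s)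
    (w : S → ℝ) (hw : ∀ s, 0 ≤ w s) :
    ∃ w' : (ζ → S) → S → ℝ, (∀ σ s, 0 ≤ w' σ s) ∧ ∑ σ, w' σ = w ∧
      ∑ σ, gap a b (w' σ) ≤ gap a b w ∧ ∀ σ, Separated a (w' σ) := by
  obtain ⟨s₀⟩ := ‹Nonempty S›
  let Q : ζ → ℝ := fun z => ∑ s, w s * a s z
  have hQ : ∀ z, 0 ≤ Q z := fun z => Finset.sum_nonneg fun s _ => mul_nonneg (hw s) (ha s z)
  -- The posterior of S given z, with a point mass as default when z has mass zero. A section σ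
  -- picks one s for each z, independently.
  let r : ζ → S → ℝ := fun z s => if Q z = 0 then (if s = s₀ then 1 else 0) else w s * a s z / Q z
  have hr0 : ∀ z s, 0 ≤ r z s := by
    intro z s
    simp only [r]
    split_ifs
    · exact zero_le_one
    · exact le_rfl
    · exact div_nonneg (mul_nonneg (hw s) (ha s z)) (hQ z)
  have hr1 : ∀ z, ∑ s, r z s = 1 := by
    intro z
    by_cases h : Q z = 0
    · simp [r, h]
    · simp only [r, h, if_false, ← Finset.sum_div]
      exact div_self h
  let π : (ζ → S) → ℝ := fun σ => ∏ z, r z (σ z)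
  have hπ0 : ∀ σ, 0 ≤ π σ := fun σ => Finset.prod_nonneg fun z _ => hr0 z _
  have hπ1 : ∑ σ, π σ = 1 := by
    simp only [π]
    rw [← Fintype.prod_sum]
    simp [hr1]
  -- All the mass `Q z` is put on the chosen point σ(z); dividing by `a` turns mass into density.
  -- Points of no mass under `a` keep their weight, so that the average over σ is `w` everywhere.
  let v : (ζ → S) → S → ℝ := fun σ s =>
    if a s (f s) = 0 then w s else if σ (f s) = s then Q (f s) / a s (f s) else 0
  have hv0 : ∀ σ s, 0 ≤ v σ s := by
    intro σ s
    simp only [v]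
    split_ifs
    · exact hw s
    · exact div_nonneg (hQ _) (ha _ _)
    · exact le_rfl
  have hsum : ∀ s, ∑ σ, π σ * v σ s = w s := by
    intro s
    by_cases h : a s (f s) = 0
    · simp only [v, h, if_true, ← Finset.sum_mul, hπ1, one_mul]
    · have e : ∀ σ, π σ * v σ s =
          (π σ * (if σ (f s) = s then 1 else 0)) * (Q (f s) / a s (f s)) := by
        intro σ
        simp only [v, h, if_false]
        split_ifs <;> simp
      rw [Finset.sum_congr rfl fun σ _ => e σ, ← Finset.sum_mul, sum_prod_section r hr1]
      simp only [r]
      by_cases hq : Q (f s) = 0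
      · have h1 := (Finset.sum_eq_zero_iff_of_nonneg fun s' _ =>
          mul_nonneg (hw s') (ha s' (f s))).1 hq s (Finset.mem_univ s)
        rw [hq, zero_div, mul_zero]
        exact ((mul_eq_zero.1 h1).resolve_right h).symm
      · rw [if_neg hq]
        field_simp
  -- Every piece of positive weight has the same Z-output as `w`, so the Z-entropy term is
  -- unaffected by the splitting.
  have hZ : ∀ σ, π σ ≠ 0 → ∀ z, ∑ s, v σ s * a s z = Q z := by
    intro σ hσ z
    rw [Finset.sum_eq_single (σ z)]
    · have hne : r z (σ z) ≠ 0 := (Finset.prod_ne_zero_iff.1 hσ) z (Finset.mem_univ z)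
      by_cases hz : Q z = 0
      · rw [hz]
        by_cases h : a (σ z) z = 0
        · rw [h, mul_zero]
        · have := hf _ _ h
          simp only [v]
          rw [← this, if_neg h, if_pos rfl, hz]
          simp
      · simp only [r, hz, if_false] at hne
        have h : a (σ z) z ≠ 0 := by
          intro h
          simp [h] at hne
        have := hf _ _ h
        simp only [v]
        rw [← this, if_neg h, if_pos rfl]
        field_simp
    · intro s _ hs
      by_cases h : a s z = 0
      · rw [h, mul_zero]
      · have := hf _ _ h
        simp only [v]
        rw [← this, if_neg h, if_neg (Ne.symm hs), zero_mul]
    · simp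
  refine ⟨fun σ => π σ • v σ, fun σ s => mul_nonneg (hπ0 σ) (hv0 σ s), ?_, ?_, fun σ => ?_⟩
  · ext s
    simpa using hsum s
  · have e : ∀ σ, gap a b (π σ • v σ) =
        ∑ j, π σ * Real.negMulLog (∑ s, v σ s * b s j) - π σ * ∑ z, Real.negMulLog (Q z) := by
      intro σ
      rw [gap_smul hab, gap, mul_sub, Finset.mul_sum]
      congr 1
      by_cases h : π σ = 0
      · simp [h]
      · simp only [hZ σ h]
    rw [Finset.sum_congr rfl fun σ _ => e σ, Finset.sum_sub_distrib, ← Finset.sum_mul, hπ1,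
      one_mul, gap, Finset.sum_comm]
    refine sub_le_sub_right (Finset.sum_le_sum fun j _ => ?_) _
    -- The J-outputs of the pieces average to that of `w`, so by Jensen their entropy terms average
    -- to no more.
    have hJ := Real.concaveOn_negMulLog.le_map_sum (t := Finset.univ) (w := π)
      (p := fun σ => ∑ s, v σ s * b s j) (fun σ _ => hπ0 σ) hπ1
      (fun σ _ => Finset.sum_nonneg fun s _ => mul_nonneg (hv0 σ s) (hb s j))
    simp only [smul_eq_mul] at hJ
    refine hJ.trans (le_of_eq (congrArg _ ?_))
    simp only [Finset.mul_sum, ← mul_assoc]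
    rw [Finset.sum_comm]
    simp only [← Finset.sum_mul, hsum]
  · refine Separated.smul (fun z s s' h1 h2 => ?_) _
    have key : ∀ s, v σ s * a s z ≠ 0 → s = σ z := by
      intro s h
      have hz := hf _ _ (right_ne_zero_of_mul h)
      have h' := left_ne_zero_of_mul h
      have hne := right_ne_zero_of_mul h
      simp only [v] at h'
      rw [← hz, if_neg hne] at h'
      by_contra hc
      rw [if_neg (fun h => hc h.symm)] at h'
      exact h' rfl
    rw [key s h1, key s' h2]

/-- Refining `U` so that `S` is determined by `(U,V,Z)`, when `Z` is a function of `S`. -/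
lemma exists_separated_kernel [DecidableEq S] [DecidableEq ζ] [Nonempty S]
    (hab : ∀ s, ∑ j, b s j = ∑ z, a s z)
    (ha : ∀ s z, 0 ≤ a s z) (hb : ∀ s j, 0 ≤ b s j) (f : S → ζ) (hf : ∀ s z, a s z ≠ 0 → z = f s)
    {w : U → V → S → ℝ} (hw : IsKernel w) :
    ∃ w' : Fin (Fintype.card S) → Fin (Fintype.card S + 1) → S → ℝ, IsKernel w' ∧
      gapV a b w' ≤ gapV a b w ∧ gapV a b w - gapUV a b w ≤ gapV a b w' - gapUV a b w' ∧
      ∀ u v, Separated a (w' u v) := by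
  -- The section σ is adjoined to U: V keeps its law and `gapUV` can only decrease. The alphabets
  -- are then shrunk, each new measure being a multiple of a separated one.
  have split := fun u v => exists_separated_split hab ha hb f hf (w u v) (hw.1 u v)
  choose k hk0 hk1 hkg hks using split
  have hV : ∀ v, ∑ x : U × (ζ → S), k x.1 v x.2 = ∑ u, w u v := by
    intro v
    rw [Fintype.sum_prod_type]
    exact Finset.sum_congr rfl fun u _ => hk1 u v
  obtain ⟨w', h1, h2, h3, h4⟩ := exists_small_kernel hab
    (w := fun (x : U × (ζ → S)) v => k x.1 v x.2) ⟨fun x v s => hk0 _ _ _ _, fun s => by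
      rw [← hw.2 s]
      refine Finset.sum_congr rfl fun v _ => ?_
      simpa only [Finset.sum_apply] using congrFun (hV v) s⟩
  have hgV : gapV a b (fun (x : U × (ζ → S)) v => k x.1 v x.2) = gapV a b w := by
    unfold gapV
    simp only [hV]
  have hgUV : gapUV a b (fun (x : U × (ζ → S)) v => k x.1 v x.2) ≤ gapUV a b w := by
    unfold gapUV
    refine Finset.sum_le_sum fun v _ => ?_
    rw [Fintype.sum_prod_type]
    exact Finset.sum_le_sum fun u _ => hkg u v
  rw [hgV] at h2 h3
  refine ⟨w', h1, h2, by linarith, fun u v => ?_⟩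
  obtain ⟨x, v₀, c, hc⟩ := h4 u v
  rw [hc]
  exact (hks x.1 v₀ x.2).smul c

end Gap

/-! ### The objective and the constraint in terms of unnormalized kernels -/

section SingleLetterLemmas

set_option linter.unusedSectionVars false

variable {𝒳 𝒴 𝒵 : Type*} [Fintype 𝒳] [Fintype 𝒴] [Fintype 𝒵]

/-- `P_{X,Y,Z}` as a function of `(X,Y)` and `Z`. -/
def lawMatrix {𝒯 : Type*} [Fintype 𝒯] (P : Law (𝒳 × 𝒴 × 𝒯)) (s : 𝒳 × 𝒴) (t : 𝒯) : ℝ :=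
  P.1 (s.1, s.2, t)

/-- The law of `(X,Y,J)`. -/
noncomputable def receiverLaw (P : Law (𝒳 × 𝒴 × 𝒵)) (J : Receiver 𝒳 𝒴 𝒵) :
    Law (𝒳 × 𝒴 × Fin J.size) :=
  ⟨fun x => ∑ z, P.1 (x.1, x.2.1, z) * (J.ker (x.1, x.2.1, z)).1 x.2.2,
    fun x => Finset.sum_nonneg fun z _ => mul_nonneg (P.2.1 _) ((J.ker _).2.1 _), by
      rw [← P.2.2]
      simp only [Fintype.sum_prod_type]
      refine Finset.sum_congr rfl fun x _ => Finset.sum_congr rfl fun y _ => ?_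
      rw [Finset.sum_comm]
      refine Finset.sum_congr rfl fun z _ => ?_
      rw [← Finset.mul_sum, (J.ker _).2.2, mul_one]⟩

/-- The conditional law of `(U,V)`, curried. -/
def Auxiliary.density (W : Auxiliary 𝒳 𝒴) (u : Fin W.sizeU) (v : Fin W.sizeV) (s : 𝒳 × 𝒴) : ℝ :=
  (W.ker s).1 (u, v)

lemma Auxiliary.isKernel_density (W : Auxiliary 𝒳 𝒴) : IsKernel W.density :=
  ⟨fun u v s => (W.ker s).2.1 _, fun s => by
    rw [← (W.ker s).2.2, Fintype.sum_prod_type_right]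
    rfl⟩

/-- The auxiliary variables with a given conditional law. -/
def Auxiliary.ofKernel {m n : ℕ} (w : Fin m → Fin n → 𝒳 × 𝒴 → ℝ) (hw : IsKernel w) :
    Auxiliary 𝒳 𝒴 :=
  ⟨m, n, fun s => ⟨fun x => w x.1 x.2 s, fun x => hw.1 _ _ _, by
    rw [← hw.2 s, Fintype.sum_prod_type_right]⟩⟩

lemma sum_receiverLaw_matrix (P : Law (𝒳 × 𝒴 × 𝒵)) (J : Receiver 𝒳 𝒴 𝒵) (s : 𝒳 × 𝒴) :
    ∑ j, lawMatrix (receiverLaw P J) s j = ∑ z, lawMatrix P s z := by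
  simp only [lawMatrix, receiverLaw]
  rw [Finset.sum_comm]
  exact Finset.sum_congr rfl fun z _ => by rw [← Finset.mul_sum, (J.ker _).2.2, mul_one]

/-- The law of `(X,Y,T,U,V)` when `(U,V) - (X,Y) - T`. -/
def auxLaw {𝒯 : Type*} [Fintype 𝒯] (P : Law (𝒳 × 𝒴 × 𝒯)) (W : Auxiliary 𝒳 𝒴) :
    𝒳 × 𝒴 × 𝒯 × Fin W.sizeU × Fin W.sizeV → ℝ :=
  fun ⟨x, y, t, u, v⟩ => P.1 (x, y, t) * (W.ker (x, y)).1 (u, v)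

lemma entropy_comp {Ω α β : Type*} [Fintype Ω] [Fintype α] [Fintype β] (p : Ω → ℝ) (A : Ω → α)
    (g : α → β) : entropy p (fun ω => g (A ω)) = entropy (prob p A) g := by
  unfold entropy
  exact Finset.sum_congr rfl fun b _ => by rw [prob_comp p A g b]

/-- Since (U,V) depends on (X,Y) alone, averaging out Z yields a law of the same form with J as
third component. No entropy used below involves J and Z jointly. -/
lemma prob_letterLaw_receiver (P : Law (𝒳 × 𝒴 × 𝒵)) (J : Receiver 𝒳 𝒴 𝒵) (W : Auxiliary 𝒳 𝒴) :
    prob (letterLaw P J W) (fun ω => (ω.1, ω.2.1, ω.2.2.2.1, ω.2.2.2.2.1, ω.2.2.2.2.2)) =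
      auxLaw (receiverLaw P J) W := by
  classical
  ext ⟨x, y, j, u, v⟩
  simp [prob, letterLaw, auxLaw, receiverLaw, Fintype.sum_prod_type, ite_and,
    Finset.sum_ite_irrel, Finset.sum_mul]

lemma prob_letterLaw_source (P : Law (𝒳 × 𝒴 × 𝒵)) (J : Receiver 𝒳 𝒴 𝒵) (W : Auxiliary 𝒳 𝒴) :
    prob (letterLaw P J W) (fun ω => (ω.1, ω.2.1, ω.2.2.1, ω.2.2.2.2.1, ω.2.2.2.2.2)) =
      auxLaw P W := by
  classical
  ext ⟨x, y, j, u, v⟩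
  simp [prob, letterLaw, auxLaw, Fintype.sum_prod_type, ite_and,
    Finset.sum_ite_irrel, ← Finset.sum_mul, ← Finset.mul_sum, (J.ker _).2.2]

section
variable {𝒯 : Type*} [Fintype 𝒯] (P : Law (𝒳 × 𝒴 × 𝒯)) (W : Auxiliary 𝒳 𝒴)

lemma prob_auxLaw_tv (t : 𝒯) (v) : prob (auxLaw P W) (fun ω => (ω.2.2.1, ω.2.2.2.2)) (t, v) =
    ∑ s, (∑ u, W.density u v) s * lawMatrix P s t := by
  classical
  simp [prob, auxLaw, Fintype.sum_prod_type, ite_and, Finset.sum_ite_irrel, ← Finset.mul_sum,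
    Auxiliary.density, lawMatrix, mul_comm]

lemma prob_auxLaw_utv (u) (t : 𝒯) (v) :
    prob (auxLaw P W) (fun ω => (ω.2.2.2.1, ω.2.2.1, ω.2.2.2.2)) (u, t, v) =
    ∑ s, W.density u v s * lawMatrix P s t := by
  classical
  simp [prob, auxLaw, Fintype.sum_prod_type, ite_and, Finset.sum_ite_irrel,
    Auxiliary.density, lawMatrix, mul_comm]

lemma prob_auxLaw_source : prob (auxLaw P W) (fun ω => (ω.1, ω.2.1, ω.2.2.1)) = P.1 := by
  classical
  ext ⟨x, y, t⟩
  have := (W.ker (x, y)).2.2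
  rw [Fintype.sum_prod_type] at this
  simp [prob, auxLaw, Fintype.sum_prod_type, ite_and, Finset.sum_ite_irrel, ← Finset.mul_sum]
  erw [this]
  simp

end


section
variable (P : Law (𝒳 × 𝒴 × 𝒵)) (J : Receiver 𝒳 𝒴 𝒵) (W : Auxiliary 𝒳 𝒴)

lemma entropy_letterLaw_receiver {γ : Type*} [Fintype γ]
    (g : 𝒳 × 𝒴 × Fin J.size × Fin W.sizeU × Fin W.sizeV → γ) :
    entropy (letterLaw P J W)
      (fun ω => g (ω.1, ω.2.1, ω.2.2.2.1, ω.2.2.2.2.1, ω.2.2.2.2.2)) =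
    entropy (auxLaw (receiverLaw P J) W) g := by
  rw [← prob_letterLaw_receiver]
  exact entropy_comp _ _ g

lemma entropy_letterLaw_source {γ : Type*} [Fintype γ]
    (g : 𝒳 × 𝒴 × 𝒵 × Fin W.sizeU × Fin W.sizeV → γ) :
    entropy (letterLaw P J W)
      (fun ω => g (ω.1, ω.2.1, ω.2.2.1, ω.2.2.2.2.1, ω.2.2.2.2.2)) =
    entropy (auxLaw P W) g := by
  rw [← prob_letterLaw_source P J W]
  exact entropy_comp _ _ g

lemma entropy_auxLaw_source {𝒯 : Type*} [Fintype 𝒯] (P : Law (𝒳 × 𝒴 × 𝒯)) (W : Auxiliary 𝒳 𝒴)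
    {γ : Type*} [Fintype γ] (g : 𝒳 × 𝒴 × 𝒯 → γ) :
    entropy (auxLaw P W) (fun ω => g (ω.1, ω.2.1, ω.2.2.1)) = entropy P.1 g := by
  rw [← prob_auxLaw_source P W]
  exact entropy_comp _ _ g

/-- `I(X;Y|J)`. -/
noncomputable def receiverInfo : ℝ :=
  condMutualInfo (receiverLaw P J).1 (fun ω => ω.1) (fun ω => ω.2.1) (fun ω => ω.2.2)

/-- `H(J)`. -/
noncomputable def receiverEntropy : ℝ :=
  entropy (receiverLaw P J).1 (fun ω => ω.2.2)

lemma gapV_density : gapV (lawMatrix P) (lawMatrix (receiverLaw P J)) W.density =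
    entropy (auxLaw (receiverLaw P J) W) (fun ω => (ω.2.2.1, ω.2.2.2.2)) -
      entropy (auxLaw P W) (fun ω => (ω.2.2.1, ω.2.2.2.2)) := by
  simp only [entropy, Fintype.sum_prod_type_right, prob_auxLaw_tv, gapV, gap,
    Finset.sum_sub_distrib]

lemma gapUV_density : gapUV (lawMatrix P) (lawMatrix (receiverLaw P J)) W.density =
    entropy (auxLaw (receiverLaw P J) W) (fun ω => (ω.2.2.2.1, ω.2.2.1, ω.2.2.2.2)) -
      entropy (auxLaw P W) (fun ω => (ω.2.2.2.1, ω.2.2.1, ω.2.2.2.2)) := by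
  simp only [entropy, Fintype.sum_prod_type, prob_auxLaw_utv, gapUV, gap,
    Finset.sum_sub_distrib]
  congr 1
  all_goals
    rw [Finset.sum_comm]
    exact Finset.sum_congr rfl fun u _ => Finset.sum_comm

/-- H(U|V) cancels between I(U;J|V) and I(U;Z|V). -/
lemma objective_eq : objective P J W = receiverInfo P J +
    gapV (lawMatrix P) (lawMatrix (receiverLaw P J)) W.density -
    gapUV (lawMatrix P) (lawMatrix (receiverLaw P J)) W.density := by
  have e1 := entropy_letterLaw_receiver P J W (fun ω => (ω.2.2.1, ω.2.2.2.2))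
  have e2 := entropy_letterLaw_source P J W (fun ω => (ω.2.2.1, ω.2.2.2.2))
  have e3 := entropy_letterLaw_receiver P J W (fun ω => (ω.2.2.2.1, ω.2.2.1, ω.2.2.2.2))
  have e4 := entropy_letterLaw_source P J W (fun ω => (ω.2.2.2.1, ω.2.2.1, ω.2.2.2.2))
  have o : objective P J W = condMutualInfo (letterLaw P J W) (fun ω => ω.1) (fun ω => ω.2.1)
      (fun ω => ω.2.2.2.1) + condMutualInfo (letterLaw P J W) (fun ω => ω.2.2.2.2.1)
        (fun ω => ω.2.2.2.1) (fun ω => ω.2.2.2.2.2) - condMutualInfo (letterLaw P J W)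
        (fun ω => ω.2.2.2.2.1) (fun ω => ω.2.2.1) (fun ω => ω.2.2.2.2.2) := rfl
  have r : condMutualInfo (letterLaw P J W) (fun ω => ω.1) (fun ω => ω.2.1)
      (fun ω => ω.2.2.2.1) = receiverInfo P J := by
    simp only [condMutualInfo, condEntropy, receiverInfo]
    congr 1
    · congr 1
      · exact entropy_letterLaw_receiver P J W (fun ω => (ω.1, ω.2.2.1)) |>.trans
          (entropy_auxLaw_source (receiverLaw P J) W fun ω => (ω.1, ω.2.2))
      · exact entropy_letterLaw_receiver P J W (fun ω => ω.2.2.1) |>.trans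
          (entropy_auxLaw_source (receiverLaw P J) W fun ω => ω.2.2)
    · congr 1
      · exact entropy_letterLaw_receiver P J W (fun ω => (ω.1, ω.2.1, ω.2.2.1)) |>.trans
          (entropy_auxLaw_source (receiverLaw P J) W fun ω => (ω.1, ω.2.1, ω.2.2))
      · exact entropy_letterLaw_receiver P J W (fun ω => (ω.2.1, ω.2.2.1)) |>.trans
          (entropy_auxLaw_source (receiverLaw P J) W fun ω => (ω.2.1, ω.2.2))
  rw [o, r, gapV_density, gapUV_density]
  simp only [condMutualInfo, condEntropy] at e1 e2 e3 e4 ⊢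
  linarith

/-- H(V) and H(Z) occur on both sides of the constraint and cancel. -/
lemma feasible_iff (Δ : ℝ) : Feasible P Δ J W ↔
    gapV (lawMatrix P) (lawMatrix (receiverLaw P J)) W.density ≤ receiverEntropy P J - Δ := by
  have e1 := entropy_letterLaw_receiver P J W (fun ω => (ω.2.2.1, ω.2.2.2.2))
  have e2 := entropy_letterLaw_source P J W (fun ω => (ω.2.2.1, ω.2.2.2.2))
  have s1 := entropy_comp_injective (letterLaw P J W) (fun ω => (ω.2.2.2.1, ω.2.2.2.2.2))
    Prod.swap_injective
  have s2 := entropy_comp_injective (letterLaw P J W) (fun ω => (ω.2.2.1, ω.2.2.2.2.2))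
    Prod.swap_injective
  have e3 := (entropy_letterLaw_receiver P J W (fun ω => ω.2.2.1)).trans
    (entropy_auxLaw_source (receiverLaw P J) W fun ω => ω.2.2)
  have o : Feasible P Δ J W ↔ mutualInfo (letterLaw P J W) (fun ω => ω.2.2.2.2.2)
      (fun ω => ω.2.2.1) ≤ mutualInfo (letterLaw P J W) (fun ω => ω.2.2.2.2.2)
      (fun ω => ω.2.2.2.1) + entropy (letterLaw P J W) (fun ω => ω.2.2.1) - Δ := Iff.rfl
  rw [o, gapV_density, receiverEntropy]
  simp only [mutualInfo, condEntropy, Prod.swap] at e1 e2 e3 s1 s2 ⊢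
  constructor <;> intro h <;> linarith

lemma negMulLog_sum_of_unique {ι : Type*} [Fintype ι] (x : ι → ℝ)
    (h : ∀ i j, x i ≠ 0 → x j ≠ 0 → i = j) :
    Real.negMulLog (∑ i, x i) = ∑ i, Real.negMulLog (x i) := by
  by_cases hx : ∃ i, x i ≠ 0
  · obtain ⟨i, hi⟩ := hx
    have h0 : ∀ j, j ≠ i → x j = 0 := fun j hj => by
      by_contra hc
      exact hj (h j i hc hi)
    rw [Finset.sum_eq_single i (fun j _ hj => h0 j hj) (by simp),
      Finset.sum_eq_single i (fun j _ hj => by simp [h0 j hj]) (by simp)]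
  · push Not at hx
    simp [hx]

/-- At each (u,v,z) at most one pair (x,y) has positive mass, so adjoining (X,Y) does not change the
entropy sum. -/
lemma determined_of_separated (h : ∀ u v, Separated (lawMatrix P) (W.density u v)) :
    Determined P J W := by
  have e1 := entropy_letterLaw_source P J W
    (fun ω => ((ω.1, ω.2.1), (ω.2.2.2.1, ω.2.2.2.2, ω.2.2.1)))
  have e2 := entropy_letterLaw_source P J W (fun ω => (ω.2.2.2.1, ω.2.2.2.2, ω.2.2.1))
  have o : Determined P J W ↔ entropy (letterLaw P J W)
      (fun ω => ((ω.1, ω.2.1), (ω.2.2.2.2.1, ω.2.2.2.2.2, ω.2.2.1))) -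
      entropy (letterLaw P J W) (fun ω => (ω.2.2.2.2.1, ω.2.2.2.2.2, ω.2.2.1)) = 0 := Iff.rfl
  rw [o, sub_eq_zero]
  simp only at e1 e2
  rw [e1, e2]
  have p1 : ∀ s u v z, prob (auxLaw P W)
      (fun ω => ((ω.1, ω.2.1), (ω.2.2.2.1, ω.2.2.2.2, ω.2.2.1))) (s, (u, v, z)) =
      W.density u v s * lawMatrix P s z := by
    classical
    rintro ⟨x, y⟩ u v z
    simp [prob, auxLaw, Fintype.sum_prod_type, ite_and, Finset.sum_ite_irrel,
      Auxiliary.density, lawMatrix, mul_comm]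
  have p2 : ∀ u v z, prob (auxLaw P W) (fun ω => (ω.2.2.2.1, ω.2.2.2.2, ω.2.2.1)) (u, v, z) =
      ∑ s, W.density u v s * lawMatrix P s z := by
    classical
    intro u v z
    simp [prob, auxLaw, Fintype.sum_prod_type, ite_and, Finset.sum_ite_irrel,
      Auxiliary.density, lawMatrix, mul_comm]
  rw [entropy, entropy, Fintype.sum_prod_type_right]
  refine Finset.sum_congr rfl fun x _ => ?_
  obtain ⟨u, v, z⟩ := x
  rw [p2, negMulLog_sum_of_unique _ (fun s s' h1 h2 => h u v z s s' h1 h2)]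
  exact Finset.sum_congr rfl fun s _ => by rw [p1]

/-! ### Attainment of the maximum -/

/-- Conditional laws of `(U,V)` on alphabets of fixed sizes, uncurried. -/
abbrev auxOfChannel {m n : ℕ} (k : Channel (𝒳 × 𝒴) (Fin m × Fin n)) : Auxiliary 𝒳 𝒴 := ⟨m, n, k⟩

lemma isCompact_channel {α β : Type*} [Fintype β] :
    IsCompact (Set.univ : Set (Channel α β)) :=
  have : CompactSpace (Law β) := isCompact_iff_compactSpace.1 (isCompact_stdSimplex ℝ β)
  isCompact_univ

lemma continuous_gap {S β ζ : Type*} [Fintype S] [Fintype β] [Fintype ζ] (a : S → ζ → ℝ)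
    (b : S → β → ℝ) : Continuous (gap a b) :=
  (continuous_finsetSum _ fun _ _ => Real.continuous_negMulLog.comp <|
    continuous_finsetSum _ fun s _ => (continuous_apply s).mul continuous_const).sub
  (continuous_finsetSum _ fun _ _ => Real.continuous_negMulLog.comp <|
    continuous_finsetSum _ fun s _ => (continuous_apply s).mul continuous_const)

lemma continuous_density {m n : ℕ} (u : Fin m) (v : Fin n) :
    Continuous fun k : Channel (𝒳 × 𝒴) (Fin m × Fin n) => (auxOfChannel k).density u v :=
  continuous_pi fun s =>
    (continuous_apply (u, v)).comp (continuous_subtype_val.comp (continuous_apply s))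

lemma continuous_gapV_density {m n : ℕ} : Continuous fun k : Channel (𝒳 × 𝒴) (Fin m × Fin n) =>
    gapV (lawMatrix P) (lawMatrix (receiverLaw P J)) (auxOfChannel k).density := by
  change Continuous fun k : Channel (𝒳 × 𝒴) (Fin m × Fin n) => ∑ v : Fin n,
    gap (lawMatrix P) (lawMatrix (receiverLaw P J)) (∑ u : Fin m, (auxOfChannel k).density u v)
  refine continuous_finsetSum _ fun v _ => ?_
  have h : Continuous fun k : Channel (𝒳 × 𝒴) (Fin m × Fin n) =>
      ∑ u : Fin m, (auxOfChannel k).density u v :=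
    continuous_finsetSum _ fun u _ => continuous_density u v
  exact (continuous_gap _ _).comp h

lemma continuous_gapUV_density {m n : ℕ} : Continuous fun k : Channel (𝒳 × 𝒴) (Fin m × Fin n) =>
    gapUV (lawMatrix P) (lawMatrix (receiverLaw P J)) (auxOfChannel k).density := by
  change Continuous fun k : Channel (𝒳 × 𝒴) (Fin m × Fin n) => ∑ v : Fin n, ∑ u : Fin m,
    gap (lawMatrix P) (lawMatrix (receiverLaw P J)) ((auxOfChannel k).density u v)
  exact continuous_finsetSum _ fun v _ => continuous_finsetSum _ fun u _ =>
    (continuous_gap (lawMatrix P) (lawMatrix (receiverLaw P J))).comp (continuous_density u v)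

lemma continuous_objective {m n : ℕ} : Continuous fun k : Channel (𝒳 × 𝒴) (Fin m × Fin n) =>
    objective P J (auxOfChannel k) := by
  simp only [objective_eq]
  exact (continuous_const.add (continuous_gapV_density P J)).sub (continuous_gapUV_density P J)

variable {P J W} in
lemma Feasible.mono {Δ Δ' : ℝ} (h : Feasible P Δ J W) (hΔ : Δ' ≤ Δ) : Feasible P Δ' J W := by
  rw [feasible_iff] at h ⊢
  linarith

lemma nonempty_of_law {α : Type*} [Fintype α] (P : Law α) : Nonempty α := by
  by_contra h
  rw [not_nonempty_iff] at h
  simpa using P.2.2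

/-- Any conditional law of `(U,V)` can be replaced by one on small alphabets. -/
lemma exists_small_channel {U V : Type*} [Fintype U] [Fintype V] {w : U → V → 𝒳 × 𝒴 → ℝ}
    (hw : IsKernel w) :
    ∃ k : Channel (𝒳 × 𝒴) (Fin (Fintype.card (𝒳 × 𝒴)) × Fin (Fintype.card (𝒳 × 𝒴) + 1)),
      gapV (lawMatrix P) (lawMatrix (receiverLaw P J)) (auxOfChannel k).density ≤
        gapV (lawMatrix P) (lawMatrix (receiverLaw P J)) w ∧
      receiverInfo P J + gapV (lawMatrix P) (lawMatrix (receiverLaw P J)) w -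
        gapUV (lawMatrix P) (lawMatrix (receiverLaw P J)) w ≤ objective P J (auxOfChannel k) := by
  obtain ⟨x, y, z⟩ := nonempty_of_law P
  have : Nonempty (𝒳 × 𝒴) := ⟨(x, y)⟩
  obtain ⟨w', h1, h2, h3, -⟩ := exists_small_kernel (sum_receiverLaw_matrix P J) hw
  refine ⟨(Auxiliary.ofKernel w' h1).ker, h2, ?_⟩
  rw [objective_eq]
  change _ ≤ receiverInfo P J + gapV _ _ w' - gapUV _ _ w'
  linarith

lemma cardBounded_auxOfChannel
    (k : Channel (𝒳 × 𝒴) (Fin (Fintype.card (𝒳 × 𝒴)) × Fin (Fintype.card (𝒳 × 𝒴) + 1))) :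
    CardBounded (auxOfChannel k) := by
  simp [CardBounded]

/-- The feasible kernels on the bounded alphabets form a closed subset of a compact set, and every
feasible competitor on larger alphabets is dominated by one of them. -/
lemma exists_maximizer (Δ : ℝ) (h : ∃ W : Auxiliary 𝒳 𝒴, Feasible P Δ J W) :
    ∃ W : Auxiliary 𝒳 𝒴, Feasible P Δ J W ∧ CardBounded W ∧
      ∀ W' : Auxiliary 𝒳 𝒴, Feasible P Δ J W' → objective P J W' ≤ objective P J W := by
  have hK : IsCompact {k : Channel (𝒳 × 𝒴)
      (Fin (Fintype.card (𝒳 × 𝒴)) × Fin (Fintype.card (𝒳 × 𝒴) + 1)) |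
      gapV (lawMatrix P) (lawMatrix (receiverLaw P J)) (auxOfChannel k).density ≤
        receiverEntropy P J - Δ} :=
    isCompact_channel.of_isClosed_subset
      (isClosed_le (continuous_gapV_density P J) continuous_const) (Set.subset_univ _)
  obtain ⟨W₀, hW₀⟩ := h
  rw [feasible_iff] at hW₀
  obtain ⟨k₀, hk₀, -⟩ := exists_small_channel P J W₀.isKernel_density
  obtain ⟨k, hk, hmax⟩ := hK.exists_isMaxOn ⟨k₀, hk₀.trans hW₀⟩
    (continuous_objective P J).continuousOn
  refine ⟨auxOfChannel k, (feasible_iff P J _ Δ).2 hk, cardBounded_auxOfChannel k,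
    fun W' hW' => ?_⟩
  rw [feasible_iff] at hW'
  obtain ⟨k', h1, h2⟩ := exists_small_channel P J W'.isKernel_density
  rw [← objective_eq] at h2
  exact h2.trans (hmax (h1.trans hW'))

/-- Approximate feasibility and optimality pass to the limit. -/
lemma exists_limit_auxiliary (Δ R : ℝ)
    (h : ∀ ε > 0, ∃ W : Auxiliary 𝒳 𝒴, Feasible P (Δ - ε) J W ∧ R - ε ≤ objective P J W) :
    ∃ W : Auxiliary 𝒳 𝒴, Feasible P Δ J W ∧ CardBounded W ∧ R ≤ objective P J W := by
  -- The larger of the constraint violation and the shortfall of the objective. Its minimum over a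
  -- compact set is at most every positive ε, hence at most 0.
  let φ : Channel (𝒳 × 𝒴) (Fin (Fintype.card (𝒳 × 𝒴)) × Fin (Fintype.card (𝒳 × 𝒴) + 1)) → ℝ :=
    fun k => max (gapV (lawMatrix P) (lawMatrix (receiverLaw P J)) (auxOfChannel k).density -
      (receiverEntropy P J - Δ)) (R - objective P J (auxOfChannel k))
  have hφ : Continuous φ := ((continuous_gapV_density P J).sub continuous_const).max
    (continuous_const.sub (continuous_objective P J))
  have small : ∀ ε > 0, ∃ k, φ k ≤ ε := by
    intro ε hε
    obtain ⟨W, h1, h2⟩ := h ε hε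
    obtain ⟨k, h3, h4⟩ := exists_small_channel P J W.isKernel_density
    rw [← objective_eq] at h4
    rw [feasible_iff] at h1
    exact ⟨k, max_le (by linarith) (by linarith)⟩
  obtain ⟨k₀, -⟩ := small 1 one_pos
  obtain ⟨k, -, hk⟩ := isCompact_channel.exists_isMinOn ⟨k₀, Set.mem_univ _⟩ hφ.continuousOn
  have hk0 : φ k ≤ 0 := le_of_forall_pos_le_add fun ε hε => by
    obtain ⟨k', hk'⟩ := small ε hε
    rw [zero_add]
    exact (hk (Set.mem_univ k')).trans hk'
  obtain ⟨h1, h2⟩ := max_le_iff.1 hk0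
  exact ⟨auxOfChannel k, (feasible_iff P J _ Δ).2 (by linarith), cardBounded_auxOfChannel k,
    by linarith⟩

lemma exists_determined (Δ : ℝ) (f : 𝒳 → 𝒴 → 𝒵) (hf : ∀ x y z, P.1 (x, y, z) ≠ 0 → z = f x y)
    (hW : Feasible P Δ J W) :
    ∃ W' : Auxiliary 𝒳 𝒴, Feasible P Δ J W' ∧ CardBounded W' ∧ Determined P J W' ∧
      objective P J W ≤ objective P J W' := by
  classical
  obtain ⟨x, y, z⟩ := nonempty_of_law P
  have : Nonempty (𝒳 × 𝒴) := ⟨(x, y)⟩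
  obtain ⟨w', h1, h2, h3, h4⟩ := exists_separated_kernel (sum_receiverLaw_matrix P J)
    (fun s z => P.2.1 _) (fun s j => (receiverLaw P J).2.1 _) (fun s => f s.1 s.2)
    (fun s z h => hf _ _ _ h) W.isKernel_density
  rw [feasible_iff] at hW
  refine ⟨Auxiliary.ofKernel w' h1, (feasible_iff P J _ Δ).2 (h2.trans hW),
    cardBounded_auxOfChannel _, determined_of_separated P J _ h4, ?_⟩
  rw [objective_eq, objective_eq]
  change _ ≤ receiverInfo P J + gapV _ _ w' - gapUV _ _ w'
  linarith

lemma psiDetermined_eq_psi (Δ : ℝ) (f : 𝒳 → 𝒴 → 𝒵)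
    (hf : ∀ x y z, P.1 (x, y, z) ≠ 0 → z = f x y) : psiDetermined P Δ = psi P Δ := by
  unfold psiDetermined psi
  refine iInf_congr fun J => le_antisymm ?_ ?_
  · exact iSup₂_le fun W hW => le_iSup₂_of_le W ⟨hW.1, hW.2.1⟩ le_rfl
  · refine iSup₂_le fun W hW => ?_
    obtain ⟨W', h1, h2, h3, h4⟩ := exists_determined P J W Δ f hf hW.1
    exact le_iSup₂_of_le W' ⟨h1, h2, h3⟩ (by exact_mod_cast h4)

end

end SingleLetterLemmas

/-! ### Public discussion does not create conditional dependence -/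

section Discussion

variable {X Y T F A B : Type*} [Fintype X] [Fintype Y] [Fintype T] [Fintype F] [Fintype A]
  [Fintype B]

/-- If the conditional law of the discussion and the keys factors into a part of Alice and a part
of Bob, then `I(A;B|T,F) ≤ I(X;Y|T)`. -/
lemma condMutualInfo_keys_le (q : X → Y → T → ℝ) (α : X → F → A → ℝ) (β : Y → F → B → ℝ)
    (hq : ∀ x y t, 0 ≤ q x y t) (hα : ∀ x f k, 0 ≤ α x f k) (hβ : ∀ y f k, 0 ≤ β y f k)
    (hq1 : ∑ x, ∑ y, ∑ t, q x y t = 1) (h1 : ∀ x y, ∑ f, (∑ k, α x f k) * ∑ k, β y f k = 1)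
    (p : X × Y × T × F × A × B → ℝ)
    (hp : ∀ x y t f k l, p (x, y, t, f, k, l) = q x y t * α x f k * β y f l) :
    condMutualInfo p (fun ω => ω.2.2.2.2.1) (fun ω => ω.2.2.2.2.2)
        (fun ω => (ω.2.2.1, ω.2.2.2.1)) ≤
      condMutualInfo p (fun ω => ω.1) (fun ω => ω.2.1) (fun ω => ω.2.2.1) := by
  have hp0 : ∀ ω, 0 ≤ p ω := fun ω => by
    obtain ⟨x, y, t, f, k, l⟩ := ω
    rw [hp]
    exact mul_nonneg (mul_nonneg (hq _ _ _) (hα _ _ _)) (hβ _ _ _)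
  have hfkl : ∀ x y t, ∑ f, ∑ k, ∑ l, p (x, y, t, f, k, l) = q x y t := by
    intro x y t
    simp only [hp]
    calc _ = q x y t * ∑ f, (∑ k, α x f k) * ∑ k, β y f k := by
          simp only [Finset.mul_sum, Finset.sum_mul, mul_assoc]
          exact Finset.sum_congr rfl fun f _ => Finset.sum_comm
      _ = q x y t := by rw [h1, mul_one]
  have hp1 : ∑ ω, p ω = 1 := by
    rw [← hq1]
    simp only [Fintype.sum_prod_type, hfkl]
  have hprob : ∀ x y t, prob p (fun ω => (ω.1, ω.2.1, ω.2.2.1)) (x, y, t) = q x y t := by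
    classical
    intro x y t
    rw [← hfkl]
    simp [prob, Fintype.sum_prod_type, ite_and, Finset.sum_ite_irrel]
    rw [Finset.sum_eq_single t (fun t' _ ht => by simp [ht]) (by simp)]
    simp
  -- Data processing in two steps: I(A;B|T,F) ≤ I(X,A;B|T,F) ≤ I(X,A;Y,B|T,F).
  have d1 := entropy_submodular hp0 hp1 (fun ω => ω.2.2.2.2.2) (fun ω => ω.1)
    (fun ω => (ω.2.2.2.2.1, (ω.2.2.1, ω.2.2.2.1)))
  have d2 := entropy_submodular hp0 hp1 (fun ω => (ω.1, ω.2.2.2.2.1)) (fun ω => ω.2.1)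
    (fun ω => (ω.2.2.2.2.2, (ω.2.2.1, ω.2.2.2.1)))
  have r1 := entropy_comp_injective p
    (fun ω => ((ω.1, ω.2.2.2.2.1), (ω.2.2.2.2.2, (ω.2.2.1, ω.2.2.2.1))))
    (g := fun x => (x.2.1, x.1.1, x.1.2, x.2.2)) (by
      rintro ⟨⟨a, b⟩, c, d⟩ ⟨⟨a', b'⟩, c', d'⟩ h
      simp only [Prod.mk.injEq] at h ⊢
      tauto)
  have r2 := entropy_comp_injective p
    (fun ω => (ω.2.2.2.2.1, (ω.2.2.2.2.2, (ω.2.2.1, ω.2.2.2.1))))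
    (g := fun x => (x.2.1, x.1, x.2.2)) (by
      rintro ⟨a, b, c⟩ ⟨a', b', c'⟩ h
      simp only [Prod.mk.injEq] at h ⊢
      tauto)
  have r3 := entropy_comp_injective p
    (fun ω => (ω.1, (ω.2.2.2.2.1, (ω.2.2.1, ω.2.2.2.1))))
    (g := fun x => ((x.1, x.2.1), x.2.2)) (by
      rintro ⟨a, b, c⟩ ⟨a', b', c'⟩ h
      simp only [Prod.mk.injEq] at h ⊢
      tauto)
  have r4 := entropy_comp_injective p
    (fun ω => (ω.2.1, (ω.2.2.2.2.2, (ω.2.2.1, ω.2.2.2.1))))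
    (g := fun x => ((x.1, x.2.1), x.2.2)) (by
      rintro ⟨a, b, c⟩ ⟨a', b', c'⟩ h
      simp only [Prod.mk.injEq] at h ⊢
      tauto)
  have r5 := entropy_comp_injective p (fun ω => ω)
    (g := fun ω => ((ω.1, ω.2.2.2.2.1), ω.2.1, (ω.2.2.2.2.2, (ω.2.2.1, ω.2.2.2.1)))) (by
      rintro ⟨a, b, c, d, e, f⟩ ⟨a', b', c', d', e', f'⟩ h
      simp only [Prod.mk.injEq] at h ⊢
      tauto)
  let pXT := prob p (fun ω => (ω.1, ω.2.2.1))
  let pYT := prob p (fun ω => (ω.2.1, ω.2.2.1))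
  let pT := prob p (fun ω => ω.2.2.1)
  have hXT : ∀ t, ∑ x, pXT (x, t) = pT t := fun t =>
    sum_prob_fst p (fun ω => ω.1) (fun ω => ω.2.2.1) t
  have hYT : ∀ t, ∑ y, pYT (y, t) = pT t := fun t =>
    sum_prob_fst p (fun ω => ω.2.1) (fun ω => ω.2.2.1) t
  have pos : ∀ ω, p ω ≠ 0 → 0 < pXT (ω.1, ω.2.2.1) ∧ 0 < pYT (ω.2.1, ω.2.2.1) ∧
      0 < pT ω.2.2.1 ∧ 0 < α ω.1 ω.2.2.2.1 ω.2.2.2.2.1 ∧ 0 < β ω.2.1 ω.2.2.2.1 ω.2.2.2.2.2 ∧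
      0 < q ω.1 ω.2.1 ω.2.2.1 := by
    intro ω hω
    refine ⟨prob_pos hp0 (fun ω => (ω.1, ω.2.2.1)) hω, prob_pos hp0 (fun ω => (ω.2.1, ω.2.2.1)) hω,
      prob_pos hp0 (fun ω => ω.2.2.1) hω, ?_⟩
    obtain ⟨x, y, t, f, k, l⟩ := ω
    rw [hp] at hω
    exact ⟨lt_of_le_of_ne (hα _ _ _) (right_ne_zero_of_mul (left_ne_zero_of_mul hω)).symm,
      lt_of_le_of_ne (hβ _ _ _) (right_ne_zero_of_mul hω).symm,
      lt_of_le_of_ne (hq _ _ _) (left_ne_zero_of_mul (left_ne_zero_of_mul hω)).symm⟩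
  -- The reference law p(t) p(x|t) p(y|t) α β makes X and Y independent given T and then runs the
  -- same discussion. It has mass 1 because `h1` holds for all pairs (x,y), including those that `q`
  -- never charges. This replaces an induction over rounds.
  have key := entropy_add_le_cross hp0 hp1 (fun ω => (ω.1, ω.2.2.2.2.1))
    (fun ω => (ω.2.1, ω.2.2.2.2.2)) (fun ω => (ω.2.2.1, ω.2.2.2.1))
    (fun a c => pXT (a.1, c.1) / pT c.1 * α a.1 c.2 a.2)
    (fun b c => pYT (b.1, c.1) * β b.1 c.2 b.2)
    (fun a c => mul_nonneg (div_nonneg (prob_nonneg hp0 _ _) (prob_nonneg hp0 _ _)) (hα _ _ _))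
    (fun b c => mul_nonneg (prob_nonneg hp0 _ _) (hβ _ _ _))
    (fun ω hω => by
      obtain ⟨a1, a2, a3, a4, a5, -⟩ := pos ω hω
      positivity)
    (fun ω hω => by
      obtain ⟨a1, a2, a3, a4, a5, -⟩ := pos ω hω
      positivity) (by
      refine le_of_eq ?_
      simp only [Fintype.sum_prod_type, ← Finset.mul_sum]
      calc _ = ∑ t, ∑ x, ∑ y, pXT (x, t) / pT t * pYT (y, t) *
            ∑ f, (∑ k, α x f k) * ∑ k, β y f k := by
            refine Finset.sum_congr rfl fun t _ => ?_
            simp only [Finset.sum_mul_sum (s := Finset.univ (α := X))]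
            rw [Finset.sum_comm]
            refine Finset.sum_congr rfl fun x _ => ?_
            rw [Finset.sum_comm]
            refine Finset.sum_congr rfl fun y _ => ?_
            rw [Finset.mul_sum]
            exact Finset.sum_congr rfl fun f _ => by ring
        _ = ∑ t, pT t := by
            simp only [h1, mul_one]
            refine Finset.sum_congr rfl fun t _ => ?_
            rw [← Finset.sum_mul_sum, ← Finset.sum_div, hXT, hYT, div_mul_eq_mul_div,
              mul_self_div_self]
        _ = 1 := (sum_prob p _).trans hp1)
  -- As p = q α β, the logarithms of α and β are those of p/q. The entropy of the whole outcome then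
  -- cancels in I(X,A;Y,B|T,F), leaving I(X;Y|T).
  have e : ∑ ω, p ω * (-Real.log (pXT (ω.1, ω.2.2.1) / pT ω.2.2.1 *
        α ω.1 ω.2.2.2.1 ω.2.2.2.2.1) -
        Real.log (pYT (ω.2.1, ω.2.2.1) * β ω.2.1 ω.2.2.2.1 ω.2.2.2.2.2)) =
      entropy p (fun ω => (ω.1, ω.2.2.1)) + entropy p (fun ω => (ω.2.1, ω.2.2.1)) -
        entropy p (fun ω => ω.2.2.1) + entropy p (fun ω => ω) -
        entropy p (fun ω => (ω.1, ω.2.1, ω.2.2.1)) := by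
    have hid : entropy p (fun ω => ω) = ∑ ω, p ω * -Real.log (p ω) := by
      rw [entropy_eq_sum]
      refine Finset.sum_congr rfl fun ω _ => ?_
      rw [prob, Finset.sum_eq_single ω (fun ω' _ h => if_neg h) (by simp), if_pos rfl]
    rw [entropy_eq_sum p fun ω => (ω.1, ω.2.2.1), entropy_eq_sum p fun ω => (ω.2.1, ω.2.2.1),
      entropy_eq_sum p fun ω => ω.2.2.1, entropy_eq_sum p fun ω => (ω.1, ω.2.1, ω.2.2.1), hid,
      ← Finset.sum_add_distrib, ← Finset.sum_sub_distrib, ← Finset.sum_add_distrib,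
      ← Finset.sum_sub_distrib]
    refine Finset.sum_congr rfl fun ω _ => ?_
    rcases eq_or_ne (p ω) 0 with h0 | h0
    · simp [h0]
    · obtain ⟨a1, a2, a3, a4, a5, a6⟩ := pos ω h0
      have hl : Real.log (p ω) = Real.log (q ω.1 ω.2.1 ω.2.2.1) +
          Real.log (α ω.1 ω.2.2.2.1 ω.2.2.2.2.1) + Real.log (β ω.2.1 ω.2.2.2.1 ω.2.2.2.2.2) := by
        rw [← Real.log_mul a6.ne' a4.ne', ← Real.log_mul (mul_pos a6 a4).ne' a5.ne', ← hp]
      rw [hl, hprob, Real.log_mul (div_pos a1 a3).ne' a4.ne', Real.log_div a1.ne' a3.ne',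
        Real.log_mul a2.ne' a5.ne']
      ring
  simp only at key d1 d2 r1 r2 r3 r4 r5
  rw [e] at key
  unfold condMutualInfo condEntropy
  linarith

end Discussion

/-! ### Independent repetitions -/

lemma sum_negMulLog_prod {γ : Type*} [Fintype γ] (r : γ → ℝ) (hr : ∑ c, r c = 1) (n : ℕ) :
    ∑ c : Fin n → γ, Real.negMulLog (∏ i, r (c i)) = n * ∑ c, Real.negMulLog (r c) := by
  induction n with
  | zero => simp
  | succ n ih =>
    rw [← (Fin.consEquiv fun _ => γ).sum_comp, Fintype.sum_prod_type]
    simp only [Fin.consEquiv_apply, Fin.prod_univ_succ, Fin.cons_zero, Fin.cons_succ,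
      Real.negMulLog_mul, Finset.sum_add_distrib, ← Finset.mul_sum, ← Finset.sum_mul, ih, hr,
      ← Fintype.prod_sum]
    simp
    ring

lemma prob_product {Λ γ : Type*} [Fintype Λ] (q : Λ → ℝ) (g : Λ → γ) {n : ℕ} (c : Fin n → γ) :
    prob (fun x : Fin n → Λ => ∏ i, q (x i)) (fun x i => g (x i)) c = ∏ i, prob q g (c i) := by
  classical
  unfold prob
  rw [Fintype.prod_sum]
  refine Finset.sum_congr rfl fun x _ => ?_
  by_cases h : (fun i => g (x i)) = c
  · subst h
    simp
  · rw [if_neg h]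
    obtain ⟨i, hi⟩ := Function.ne_iff.1 h
    exact (Finset.prod_eq_zero (Finset.mem_univ i) (if_neg hi)).symm

lemma entropy_product {Λ γ : Type*} [Fintype Λ] [Fintype γ] (q : Λ → ℝ) (hq : ∑ x, q x = 1) (g : Λ → γ) (n : ℕ) :
    entropy (fun x : Fin n → Λ => ∏ i, q (x i)) (fun x i => g (x i)) = n * entropy q g := by
  unfold entropy
  simp only [prob_product]
  exact sum_negMulLog_prod _ ((sum_prob q g).trans hq) n

/-! ### Single-letterization by a hybrid argument -/

section Hybrid

set_option linter.unusedSectionVars false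

variable {S β ζ D : Type*} [Fintype S] [Fintype β] [Fintype ζ] [Fintype D] {n : ℕ}

/-- Output entropy of a measure on sequences passed through position-dependent matrices. -/
noncomputable def outputEntropy {N : ℕ} (C : Fin N → S → D → ℝ) (μ : (Fin N → S) → ℝ) : ℝ :=
  ∑ t : Fin N → D, Real.negMulLog (∑ s, μ s * ∏ l, C l (s l) (t l))

/-- Output symbols of zero weight do not affect entropy. This identifies the two extreme hybrids,
whose alphabet is `ζ ⊕ β`, with the pure Z- and J-outputs. -/
lemma outputEntropy_comp_injective {D' : Type*} [Fintype D'] {N : ℕ} (C : Fin N → S → D → ℝ)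
    (C' : Fin N → S → D' → ℝ) {g : D' → D} (hg : g.Injective) (hC : ∀ l s d, C l s (g d) = C' l s d)
    (h0 : ∀ l s d, d ∉ Set.range g → C l s d = 0) (μ : (Fin N → S) → ℝ) :
    outputEntropy C μ = outputEntropy C' μ := by
  refine (Fintype.sum_of_injective (fun (t : Fin N → D') l => g (t l))
    hg.comp_left _ _ (fun t ht => ?_) fun t => by simp only [hC]).symm
  obtain ⟨l, hl⟩ : ∃ l, t l ∉ Set.range g := by
    by_contra hc
    push Not at hc
    choose t' ht' using hc
    exact ht ⟨t', funext ht'⟩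
  rw [Finset.sum_eq_zero fun s _ => ?_, Real.negMulLog_zero]
  rw [Finset.prod_eq_zero (Finset.mem_univ l) (h0 _ _ _ hl), mul_zero]

/-- The measure on the letter in position `i` jointly with the outputs `t` elsewhere. -/
def letterSlice (C : Fin (n + 1) → S → D → ℝ) (i : Fin (n + 1)) (μ : (Fin (n + 1) → S) → ℝ)
    (t : Fin n → D) (x : S) : ℝ :=
  ∑ s : Fin n → S, μ (i.insertNth x s) * ∏ l, C (i.succAbove l) (s l) (t l)

lemma sum_insertNth {M : Type*} [AddCommMonoid M] (i : Fin (n + 1)) (φ : (Fin (n + 1) → S) → M) :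
    ∑ s, φ s = ∑ x, ∑ s : Fin n → S, φ (i.insertNth x s) := by
  rw [← (Fin.insertNthEquiv (fun _ => S) i).sum_comp, Fintype.sum_prod_type]
  rfl

lemma outputEntropy_eq_slice (C : Fin (n + 1) → S → D → ℝ) (i : Fin (n + 1))
    (μ : (Fin (n + 1) → S) → ℝ) :
    outputEntropy C μ =
      ∑ t, ∑ d, Real.negMulLog (∑ x, letterSlice C i μ t x * C i x d) := by
  unfold outputEntropy letterSlice
  rw [sum_insertNth i, Finset.sum_comm]
  refine Finset.sum_congr rfl fun t _ => Finset.sum_congr rfl fun d _ => congrArg _ ?_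
  rw [sum_insertNth i]
  refine Finset.sum_congr rfl fun x _ => ?_
  rw [Finset.sum_mul]
  refine Finset.sum_congr rfl fun s _ => ?_
  rw [Fin.prod_univ_succAbove _ i]
  simp only [Fin.insertNth_apply_same, Fin.insertNth_apply_succAbove]
  ring

/-- The first `i` letters are observed through `b` and the others through `a`. -/
def hybrid (a : S → ζ → ℝ) (b : S → β → ℝ) (i : ℕ) {N : ℕ} (l : Fin N) (s : S) : ζ ⊕ β → ℝ :=
  if l.val < i then Sum.elim 0 (b s) else Sum.elim (a s) 0

variable (a : S → ζ → ℝ) (b : S → β → ℝ)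

/-- Consecutive hybrids differ only at position i, which the slice leaves unobserved. -/
lemma letterSlice_hybrid_succ (i : Fin (n + 1)) (μ : (Fin (n + 1) → S) → ℝ) :
    letterSlice (hybrid a b (i + 1)) i μ = letterSlice (hybrid a b i) i μ := by
  ext t x
  unfold letterSlice
  refine Finset.sum_congr rfl fun s _ => congrArg _ (Finset.prod_congr rfl fun l _ => ?_)
  have h : (i.succAbove l).val ≠ i := fun h => Fin.succAbove_ne i l (Fin.ext h)
  have : (i.succAbove l).val < i + 1 ↔ (i.succAbove l).val < i := by omega
  simp only [hybrid, this]

lemma outputEntropy_hybrid_step (i : Fin (n + 1)) (μ : (Fin (n + 1) → S) → ℝ) :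
    outputEntropy (hybrid a b (i + 1)) μ - outputEntropy (hybrid a b i) μ =
      ∑ t, gap a b (letterSlice (hybrid a b i) i μ t) := by
  rw [outputEntropy_eq_slice _ i, outputEntropy_eq_slice _ i, letterSlice_hybrid_succ,
    ← Finset.sum_sub_distrib]
  refine Finset.sum_congr rfl fun t _ => ?_
  simp [hybrid, gap, Fintype.sum_sum_type]

/-- A telescoping sum over hybrids; it plays the role of Csiszár's sum identity. -/
lemma sum_gap_letterSlice (μ : (Fin (n + 1) → S) → ℝ) :
    ∑ i : Fin (n + 1), ∑ t, gap a b (letterSlice (hybrid a b i) i μ t) =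
      outputEntropy (fun _ => b) μ - outputEntropy (fun _ => a) μ := by
  have h0 : outputEntropy (hybrid a b 0) μ = outputEntropy (fun _ => a) μ :=
    outputEntropy_comp_injective _ _ Sum.inl_injective (by simp [hybrid])
      (by rintro l s (z | j) h <;> simp_all [hybrid]) μ
  have h1 : outputEntropy (hybrid a b (n + 1)) μ = outputEntropy (fun _ => b) μ :=
    outputEntropy_comp_injective _ _ Sum.inr_injective
      (fun l s j => by simp [hybrid, Nat.lt_succ_iff.1 l.isLt])
      (by
        rintro l s (z | j) h
        · simp [hybrid, Nat.lt_succ_iff.1 l.isLt]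
        · simp at h) μ
  rw [← h0, ← h1, ← Finset.sum_range_sub fun i => outputEntropy (hybrid a b i) μ,
    ← Fin.sum_univ_eq_sum_range (fun i => outputEntropy (hybrid a b (i + 1)) μ -
      outputEntropy (hybrid a b i) μ)]
  exact Finset.sum_congr rfl fun i _ => (outputEntropy_hybrid_step a b i μ).symm

variable {a b} {U V : Type*} [Fintype U] [Fintype V]

lemma sum_hybrid (hab : ∀ s, ∑ j, b s j = ∑ z, a s z) (i : ℕ) {N : ℕ} (l : Fin N) (s : S) :
    ∑ d, hybrid a b i l s d = ∑ z, a s z := by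
  simp only [hybrid]
  split_ifs <;> simp [Fintype.sum_sum_type, hab]

lemma sum_letterSlice (C : Fin (n + 1) → S → D → ℝ) (i : Fin (n + 1))
    (κ : U → (Fin (n + 1) → S) → ℝ) (t : Fin n → D) :
    ∑ u, letterSlice C i (κ u) t = letterSlice C i (∑ u, κ u) t := by
  ext x
  simp only [letterSlice, Finset.sum_apply, Finset.sum_mul]
  exact Finset.sum_comm

/-- From a conditional law `κ` of `(U,V)` given a source sequence, a single-letter conditional law
whose entropy differences are the per-letter averages of those of the sequences. -/
lemma exists_singleLetter_kernel (hab : ∀ s, ∑ j, b s j = ∑ z, a s z)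
    (ha : ∀ s z, 0 ≤ a s z) (hb : ∀ s j, 0 ≤ b s j) (ha1 : ∑ s, ∑ z, a s z = 1)
    (κ : U → V → (Fin (n + 1) → S) → ℝ) (hκ : IsKernel κ) :
    ∃ w : U → Fin (n + 1) × V × (Fin n → ζ ⊕ β) → S → ℝ, IsKernel w ∧
      (n + 1) * gapV a b w = ∑ v, (outputEntropy (fun _ => b) (∑ u, κ u v) -
        outputEntropy (fun _ => a) (∑ u, κ u v)) ∧
      (n + 1) * gapUV a b w = ∑ v, ∑ u, (outputEntropy (fun _ => b) (κ u v) -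
        outputEntropy (fun _ => a) (κ u v)) := by
  have hn : ((n : ℝ) + 1) ≠ 0 := by positivity
  have hC : ∀ (i : ℕ) (l : Fin (n + 1)) s d, 0 ≤ hybrid a b i l s d := by
    intro i l s d
    simp only [hybrid]
    split_ifs <;> cases d <;> simp [ha, hb]
  -- With the letter at position i fixed, κ sums to 1 at every sequence, and the outputs elsewhere
  -- then sum to the total mass of i.i.d. letters.
  have hmass : ∀ (i : Fin (n + 1)) s,
      ∑ v, ∑ t, ∑ u, letterSlice (hybrid a b i) i (κ u v) t s = 1 := by
    intro i x
    simp only [letterSlice]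
    calc _ = ∑ s : Fin n → S, (∑ v, ∑ u, κ u v (i.insertNth x s)) *
          ∏ l, ∑ d, hybrid a b i (i.succAbove l) (s l) d := by
          simp only [Fintype.prod_sum, Finset.sum_mul]
          rw [Finset.sum_comm (s := (Finset.univ : Finset (Fin n → S)))]
          refine Finset.sum_congr rfl fun v _ => ?_
          rw [Finset.sum_comm, Finset.sum_comm (s := (Finset.univ : Finset (Fin n → S)))]
          refine Finset.sum_congr rfl fun u _ => ?_
          rw [Finset.sum_comm]
          exact Finset.sum_congr rfl fun s _ => (Finset.mul_sum _ _ _).symm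
      _ = 1 := by
          simp only [hκ.2, one_mul, sum_hybrid hab]
          rw [← Fintype.prod_sum (fun (_ : Fin n) s => ∑ z, a s z)]
          simp [ha1]
  -- The new V is a uniform position i, the old V, and the outputs elsewhere: J before i and Z after
  -- i. U is unchanged.
  let w : U → Fin (n + 1) × V × (Fin n → ζ ⊕ β) → S → ℝ := fun u x =>
    ((n : ℝ) + 1)⁻¹ • letterSlice (hybrid a b x.1) x.1 (κ u x.2.1) x.2.2
  refine ⟨w, ⟨fun u x s => ?_, fun s => ?_⟩, ?_, ?_⟩
  · exact mul_nonneg (by positivity) (Finset.sum_nonneg fun s _ =>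
      mul_nonneg (hκ.1 _ _ _) (Finset.prod_nonneg fun l _ => hC _ _ _ _))
  · simp only [w, Pi.smul_apply, smul_eq_mul, ← Finset.mul_sum, Fintype.sum_prod_type, hmass]
    simp
    field_simp
  · simp only [gapV, w, ← Finset.smul_sum, sum_letterSlice, gap_smul hab, ← Finset.mul_sum,
      Fintype.sum_prod_type]
    rw [mul_inv_cancel_left₀ hn, Finset.sum_comm]
    exact Finset.sum_congr rfl fun v _ => sum_gap_letterSlice a b _
  · simp only [gapUV, w, gap_smul hab, ← Finset.mul_sum, Fintype.sum_prod_type]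
    rw [mul_inv_cancel_left₀ hn, Finset.sum_comm]
    refine Finset.sum_congr rfl fun v _ => ?_
    simp only [← sum_gap_letterSlice]
    rw [Finset.sum_comm (s := (Finset.univ : Finset U))]
    exact Finset.sum_congr rfl fun i _ => Finset.sum_comm

end Hybrid

/-! ### The converse -/

namespace Protocol

set_option linter.unusedSectionVars false

/-- The last message is summed out first, since earlier factors do not see it. -/
lemma sum_prod_past {M : ℕ} (K : (i : ℕ) → (Fin i → Fin M) → Law (Fin M)) (r : ℕ) :
    ∑ f : Fin r → Fin M, ∏ i : Fin r, (K i fun j => f (Fin.castLE i.isLt.le j)).1 (f i) = 1 := by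
  induction r with
  | zero => simp
  | succ r ih =>
    rw [← (Fin.snocEquiv fun _ => Fin M).sum_comp, Fintype.sum_prod_type, Finset.sum_comm, ← ih]
    refine Finset.sum_congr rfl fun g _ => ?_
    have h : ∀ a : Fin M, ∏ i : Fin (r + 1),
        (K i fun j => (Fin.snocEquiv fun _ => Fin M) (a, g) (Fin.castLE i.isLt.le j)).1
          ((Fin.snocEquiv fun _ => Fin M) (a, g) i) =
        (∏ i : Fin r, (K i fun j => g (Fin.castLE i.isLt.le j)).1 (g i)) * (K r g).1 a := by
      intro a
      rw [Fin.prod_univ_castSucc]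
      have e : ∀ (i : ℕ) (hi : i ≤ r) (j : Fin i),
          (Fin.snocEquiv fun _ : Fin (r + 1) => Fin M) (a, g)
            (Fin.castLE (hi.trans (Nat.le_succ r)) j) = g (Fin.castLE hi j) := fun i hi j =>
        Fin.snoc_castSucc (α := fun _ : Fin (r + 1) => Fin M) a g (Fin.castLE hi j)
      congr 1
      · refine Finset.prod_congr rfl fun i _ => ?_
        have e1 : (Fin.snocEquiv fun _ : Fin (r + 1) => Fin M) (a, g) i.castSucc = g i :=
          Fin.snoc_castSucc (α := fun _ : Fin (r + 1) => Fin M) a g i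
        rw [e1]
        have e2 := funext (e i i.isLt.le)
        exact congrArg (fun q => (K i q).1 (g i)) e2
      · have e1 : (Fin.snocEquiv fun _ : Fin (r + 1) => Fin M) (a, g) (Fin.last r) = a :=
          Fin.snoc_last (α := fun _ : Fin (r + 1) => Fin M) a g
        rw [e1]
        have e2 := funext (e r le_rfl)
        exact congrArg (fun q => (K r q).1 a) e2
    simp only [h, ← Finset.mul_sum, (K r g).2.2, mul_one]

variable {𝒳 𝒴 𝒯 : Type*} {n : ℕ} (c : Protocol 𝒳 𝒴 n)

lemma sum_transcriptProb (x : Fin n → 𝒳) (y : Fin n → 𝒴) : ∑ f, c.transcriptProb x y f = 1 := by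
  rw [← sum_prod_past (fun i g => if Even i then c.aliceMsg i (x, g) else c.bobMsg i (y, g))
    c.rounds]
  refine Finset.sum_congr rfl fun f _ => Finset.prod_congr rfl fun i _ => ?_
  by_cases h : Even i.val
  · simp only [h, if_true]
    rfl
  · simp only [h, if_false]
    rfl

/-- Alice's factor of the conditional law of transcript and keys. -/
def aliceSide (x : Fin n → 𝒳) (f : c.Transcript) (k : Fin c.keys) : ℝ :=
  (∏ i : Fin c.rounds, if Even i.val then (c.aliceMsg i.val (x, c.past f i)).1 (f i) else 1) *
    (c.aliceKey (x, f)).1 k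

/-- Bob's factor of the conditional law of transcript and keys. -/
def bobSide (y : Fin n → 𝒴) (f : c.Transcript) (k : Fin c.keys) : ℝ :=
  (∏ i : Fin c.rounds, if Even i.val then 1 else (c.bobMsg i.val (y, c.past f i)).1 (f i)) *
    (c.bobKey (y, f)).1 k

lemma transcriptProb_nonneg (x : Fin n → 𝒳) (y : Fin n → 𝒴) (f : c.Transcript) :
    0 ≤ c.transcriptProb x y f :=
  Finset.prod_nonneg fun i _ => by
    split_ifs
    · exact (c.aliceMsg _ _).2.1 _
    · exact (c.bobMsg _ _).2.1 _

lemma aliceSide_nonneg (x : Fin n → 𝒳) (f : c.Transcript) (k : Fin c.keys) :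
    0 ≤ c.aliceSide x f k :=
  mul_nonneg (Finset.prod_nonneg fun i _ => by
    split_ifs
    · exact (c.aliceMsg _ _).2.1 _
    · exact zero_le_one) ((c.aliceKey _).2.1 _)

lemma bobSide_nonneg (y : Fin n → 𝒴) (f : c.Transcript) (k : Fin c.keys) :
    0 ≤ c.bobSide y f k :=
  mul_nonneg (Finset.prod_nonneg fun i _ => by
    split_ifs
    · exact zero_le_one
    · exact (c.bobMsg _ _).2.1 _) ((c.bobKey _).2.1 _)

lemma aliceSide_mul_bobSide (x : Fin n → 𝒳) (y : Fin n → 𝒴) (f : c.Transcript)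
    (k l : Fin c.keys) : c.aliceSide x f k * c.bobSide y f l =
      c.transcriptProb x y f * (c.aliceKey (x, f)).1 k * (c.bobKey (y, f)).1 l := by
  have : c.transcriptProb x y f =
      (∏ i : Fin c.rounds, if Even i.val then (c.aliceMsg i.val (x, c.past f i)).1 (f i) else 1) *
      ∏ i : Fin c.rounds, if Even i.val then 1 else (c.bobMsg i.val (y, c.past f i)).1 (f i) := by
    rw [transcriptProb, ← Finset.prod_mul_distrib]
    exact Finset.prod_congr rfl fun i _ => by split_ifs <;> simp
  rw [this, aliceSide, bobSide]
  ring

/-- The normalization required by `condMutualInfo_keys_le`, valid also for sequence pairs of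
probability zero. -/
lemma sum_sides (x : Fin n → 𝒳) (y : Fin n → 𝒴) :
    ∑ f, (∑ k, c.aliceSide x f k) * ∑ k, c.bobSide y f k = 1 := by
  rw [← c.sum_transcriptProb x y]
  refine Finset.sum_congr rfl fun f _ => ?_
  rw [Finset.sum_mul_sum]
  simp only [aliceSide_mul_bobSide, ← Finset.mul_sum, (c.bobKey _).2.2, (c.aliceKey _).2.2, mul_one]

variable [Fintype 𝒳] [Fintype 𝒴] [Fintype 𝒯] (P : Law (𝒳 × 𝒴 × 𝒯))

lemma jointLaw_apply (x : Fin n → 𝒳) (y : Fin n → 𝒴) (t : Fin n → 𝒯) (f : c.Transcript)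
    (k l : Fin c.keys) : c.jointLaw P (x, y, t, f, k, l) =
      (∏ i, P.1 (x i, y i, t i)) * c.aliceSide x f k * c.bobSide y f l := by
  rw [mul_assoc, aliceSide_mul_bobSide]
  simp only [jointLaw]
  ring

lemma prod_law_nonneg (x : Fin n → 𝒳) (y : Fin n → 𝒴) (t : Fin n → 𝒯) :
    0 ≤ ∏ i, P.1 (x i, y i, t i) := Finset.prod_nonneg fun _ _ => P.2.1 _

lemma jointLaw_nonneg (ω : c.Outcome 𝒯) : 0 ≤ c.jointLaw P ω := by
  obtain ⟨x, y, t, f, k, l⟩ := ω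
  rw [jointLaw_apply]
  exact mul_nonneg (mul_nonneg (prod_law_nonneg P x y t) (c.aliceSide_nonneg _ _ _))
    (c.bobSide_nonneg _ _ _)

lemma sum_jointLaw_discussion (x : Fin n → 𝒳) (y : Fin n → 𝒴) (t : Fin n → 𝒯) :
    ∑ f, ∑ k, ∑ l, c.jointLaw P (x, y, t, f, k, l) = ∏ i, P.1 (x i, y i, t i) := by
  simp only [jointLaw, ← Finset.mul_sum, (c.bobKey _).2.2, (c.aliceKey _).2.2, mul_one,
    sum_transcriptProb]

/-- The source sequences as a sequence of letters. -/
def letters (ω : c.Outcome 𝒯) (i : Fin n) : 𝒳 × 𝒴 × 𝒯 := (ω.1 i, ω.2.1 i, ω.2.2.1 i)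

lemma prob_letters : prob (c.jointLaw P) c.letters = fun d => ∏ i, P.1 (d i) := by
  classical
  ext d
  have h := prob_comp_injective (c.jointLaw P) (fun ω => (ω.1, ω.2.1, ω.2.2.1))
    (g := fun (x : (Fin n → 𝒳) × (Fin n → 𝒴) × (Fin n → 𝒯)) i => (x.1 i, x.2.1 i, x.2.2 i)) (by
      rintro ⟨a, b, c⟩ ⟨a', b', c'⟩ h
      simp only [funext_iff, Prod.mk.injEq] at h ⊢
      exact ⟨fun i => (h i).1, fun i => (h i).2.1, fun i => (h i).2.2⟩)
    (fun i => (d i).1, fun i => (d i).2.1, fun i => (d i).2.2)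
  refine h.trans (Eq.trans ?_ (c.sum_jointLaw_discussion P (fun i => (d i).1)
    (fun i => (d i).2.1) (fun i => (d i).2.2)))
  simp only [prob, Fintype.sum_prod_type, Prod.mk.injEq]
  rw [Finset.sum_eq_single (fun i => (d i).1) (fun _ _ h => by simp [h]) (by simp),
    Finset.sum_eq_single (fun i => (d i).2.1) (fun _ _ h => by simp [h]) (by simp),
    Finset.sum_eq_single (fun i => (d i).2.2) (fun _ _ h => by simp [h]) (by simp)]
  simp

lemma sum_jointLaw : ∑ ω, c.jointLaw P ω = 1 := by
  rw [← sum_prob (c.jointLaw P) c.letters, prob_letters]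
  simp only
  rw [← Fintype.prod_sum (fun (_ : Fin n) s => P.1 s)]
  simp [P.2.2]

lemma entropy_letters {γ : Type*} [Fintype γ] (g : 𝒳 × 𝒴 × 𝒯 → γ) :
    entropy (c.jointLaw P) (fun ω i => g (c.letters ω i)) = n * entropy P.1 g := by
  rw [← entropy_product P.1 P.2.2 g n, ← prob_letters c P]
  exact entropy_comp (c.jointLaw P) c.letters fun d i => g (d i)

lemma condMutualInfo_sequences :
    condMutualInfo (c.jointLaw P) (fun ω => ω.1) (fun ω => ω.2.1) (fun ω => ω.2.2.1) =
      n * condMutualInfo P.1 (fun ω => ω.1) (fun ω => ω.2.1) (fun ω => ω.2.2) := by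
  have h1 := c.entropy_letters P (fun ω => (ω.1, ω.2.2))
  have h2 := c.entropy_letters P (fun ω => ω.2.2)
  have h3 := c.entropy_letters P (fun ω => (ω.1, ω.2.1, ω.2.2))
  have h4 := c.entropy_letters P (fun ω => (ω.2.1, ω.2.2))
  have r1 := entropy_comp_injective (c.jointLaw P) (fun ω => (ω.1, ω.2.2.1))
    (g := fun (x : (Fin n → 𝒳) × (Fin n → 𝒯)) i => (x.1 i, x.2 i)) (by
      rintro ⟨a, b⟩ ⟨a', b'⟩ h
      simp only [funext_iff, Prod.mk.injEq] at h ⊢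
      exact ⟨fun i => (h i).1, fun i => (h i).2⟩)
  have r3 := entropy_comp_injective (c.jointLaw P) (fun ω => (ω.1, ω.2.1, ω.2.2.1))
    (g := fun (x : (Fin n → 𝒳) × (Fin n → 𝒴) × (Fin n → 𝒯)) i => (x.1 i, x.2.1 i, x.2.2 i)) (by
      rintro ⟨a, b, c⟩ ⟨a', b', c'⟩ h
      simp only [funext_iff, Prod.mk.injEq] at h ⊢
      exact ⟨fun i => (h i).1, fun i => (h i).2.1, fun i => (h i).2.2⟩)
  have r4 := entropy_comp_injective (c.jointLaw P) (fun ω => (ω.2.1, ω.2.2.1))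
    (g := fun (x : (Fin n → 𝒴) × (Fin n → 𝒯)) i => (x.1 i, x.2 i)) (by
      rintro ⟨a, b⟩ ⟨a', b'⟩ h
      simp only [funext_iff, Prod.mk.injEq] at h ⊢
      exact ⟨fun i => (h i).1, fun i => (h i).2⟩)
  simp only [letters] at h1 h2 h3 h4
  unfold condMutualInfo condEntropy
  linarith

lemma condMutualInfo_keys :
    condMutualInfo (c.jointLaw P) (fun ω => ω.2.2.2.2.1) (fun ω => ω.2.2.2.2.2)
        (fun ω => (ω.2.2.1, ω.2.2.2.1)) ≤
      n * condMutualInfo P.1 (fun ω => ω.1) (fun ω => ω.2.1) (fun ω => ω.2.2) := by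
  rw [← condMutualInfo_sequences c P]
  refine condMutualInfo_keys_le (fun x y t => ∏ i, P.1 (x i, y i, t i)) c.aliceSide c.bobSide
    (prod_law_nonneg P) c.aliceSide_nonneg c.bobSide_nonneg ?_ c.sum_sides _ (c.jointLaw_apply P)
  rw [← c.sum_jointLaw P]
  simp only [Fintype.sum_prod_type, sum_jointLaw_discussion]

/-- The marginal law of `(X^n, Y^n, F, K_A, K_B)` depends on the source law only through the law
of `(X,Y)`. -/
lemma prob_discussion (x : Fin n → 𝒳) (y : Fin n → 𝒴) (d : c.Transcript × Fin c.keys × Fin c.keys) :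
    prob (c.jointLaw P) (fun ω => (ω.1, ω.2.1, ω.2.2.2)) (x, y, d) =
      (∏ i, ∑ t, lawMatrix P (x i, y i) t) * c.aliceSide x d.1 d.2.1 * c.bobSide y d.1 d.2.2 := by
  classical
  obtain ⟨f, k, l⟩ := d
  rw [Fintype.prod_sum]
  simp only [Finset.sum_mul, lawMatrix, ← jointLaw_apply]
  simp only [prob, Fintype.sum_prod_type, Prod.mk.injEq]
  rw [Finset.sum_eq_single x (fun _ _ h => by simp [h]) (by simp),
    Finset.sum_eq_single y (fun _ _ h => by simp [h]) (by simp)]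
  refine Finset.sum_congr rfl fun t _ => ?_
  rw [Finset.sum_eq_single f (fun _ _ h => by simp [h]) (by simp),
    Finset.sum_eq_single k (fun _ _ h => by simp [h]) (by simp),
    Finset.sum_eq_single l (fun _ _ h => by simp [h]) (by simp)]
  simp

/-- The conditional law of Alice's key and the transcript given the sequence of pairs. -/
def keyKernel (k : Fin c.keys) (f : c.Transcript) (s : Fin n → 𝒳 × 𝒴) : ℝ :=
  c.transcriptProb (fun i => (s i).1) (fun i => (s i).2) f * (c.aliceKey (fun i => (s i).1, f)).1 k

lemma isKernel_keyKernel : IsKernel c.keyKernel :=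
  ⟨fun k f s => mul_nonneg (c.transcriptProb_nonneg _ _ _) ((c.aliceKey _).2.1 _), fun s => by
    simp only [keyKernel, ← Finset.mul_sum, (c.aliceKey _).2.2, mul_one, sum_transcriptProb]⟩

lemma prob_key_eve (k : Fin c.keys) (t : Fin n → 𝒯) (f : c.Transcript) :
    prob (c.jointLaw P) (fun ω => (ω.2.2.2.2.1, ω.2.2.1, ω.2.2.2.1)) (k, t, f) =
      ∑ s, c.keyKernel k f s * ∏ l, lawMatrix P (s l) (t l) := by
  classical
  rw [← (Equiv.arrowProdEquivProdArrow (Fin n) (fun _ => 𝒳) (fun _ => 𝒴)).symm.sum_comp,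
    Fintype.sum_prod_type]
  simp only [prob, Fintype.sum_prod_type, Prod.mk.injEq]
  refine Finset.sum_congr rfl fun x _ => Finset.sum_congr rfl fun y _ => ?_
  rw [Finset.sum_eq_single t (fun _ _ h => by simp [h]) (by simp),
    Finset.sum_eq_single f (fun _ _ h => by simp [h]) (by simp),
    Finset.sum_eq_single k (fun _ _ h => by simp [h]) (by simp)]
  simp only [jointLaw, and_self, if_true, ← Finset.mul_sum, (c.bobKey _).2.2, mul_one]
  simp only [keyKernel, lawMatrix, Equiv.arrowProdEquivProdArrow_symm_apply]
  ring

lemma entropy_key_eve :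
    entropy (c.jointLaw P) (fun ω => (ω.2.2.2.2.1, ω.2.2.1, ω.2.2.2.1)) =
      ∑ f, ∑ k, outputEntropy (fun _ => lawMatrix P) (c.keyKernel k f) := by
  unfold entropy outputEntropy
  simp only [Fintype.sum_prod_type, prob_key_eve]
  refine (Finset.sum_congr rfl fun k _ => Finset.sum_comm).trans ?_
  rw [Finset.sum_comm]

lemma entropy_eve :
    entropy (c.jointLaw P) (fun ω => (ω.2.2.1, ω.2.2.2.1)) =
      ∑ f, outputEntropy (fun _ => lawMatrix P) (∑ k, c.keyKernel k f) := by
  unfold entropy outputEntropy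
  simp only [Fintype.sum_prod_type_right]
  refine Finset.sum_congr rfl fun f _ => Finset.sum_congr rfl fun t _ => congrArg _ ?_
  rw [← sum_prob_fst (c.jointLaw P) (fun ω => ω.2.2.2.2.1) (fun ω => (ω.2.2.1, ω.2.2.2.1))]
  simp only [prob_key_eve, Finset.sum_apply, Finset.sum_mul]
  exact Finset.sum_comm

/-! ### Auxiliary variables extracted from a code -/

section Converse

variable {𝒵 : Type*} [Fintype 𝒵] (Q : Law (𝒳 × 𝒴 × 𝒵)) (J : Receiver 𝒳 𝒴 𝒵)

/-- Replacing Z by J keeps the law of (X,Y), and the parties never see the third component. Facts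
about transcript and keys thus carry over from one source to the other. -/
lemma prob_discussion_receiver :
    prob (c.jointLaw (receiverLaw Q J)) (fun ω => (ω.1, ω.2.1, ω.2.2.2)) =
      prob (c.jointLaw Q) (fun ω => (ω.1, ω.2.1, ω.2.2.2)) := by
  ext ⟨x, y, d⟩
  simp only [prob_discussion, sum_receiverLaw_matrix]

/-- The single-letter auxiliary variables extracted from a protocol. -/
lemma exists_auxiliary (hn : 0 < n) {δ Δ : ℝ} (hδ : 0 ≤ δ) (hcode : c.IsCode Q δ)
    (heq : Δ ≤ c.equivocation Q) :
    ∃ W : Auxiliary 𝒳 𝒴, Feasible Q Δ J W ∧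
      (1 - δ) * c.keyRate Q - δ - δ ^ 2 - Real.log 2 / n ≤ objective Q J W := by
  obtain ⟨m, rfl⟩ : ∃ m, n = m + 1 := ⟨n - 1, by omega⟩
  have hn' : (0 : ℝ) < ((m + 1 : ℕ) : ℝ) := by positivity
  obtain ⟨hagree, hunif, hleak⟩ := hcode
  set N : ℝ := ((m + 1 : ℕ) : ℝ) with hN
  have hNm : N = m + 1 := by simp [hN]
  set p := c.jointLaw Q with hp
  set p' := c.jointLaw (receiverLaw Q J) with hp'
  have p0 : ∀ ω, 0 ≤ p' ω := c.jointLaw_nonneg _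
  have p1 : ∑ ω, p' ω = 1 := c.sum_jointLaw _
  have hrate : c.keyRate Q = entropy p (fun ω => ω.2.2.2.2.1) / N := rfl
  have hleak' : (entropy p (fun ω => ω.2.2.2.2.1) -
      (entropy p (fun ω => (ω.2.2.2.2.1, ω.2.2.1, ω.2.2.2.1)) -
        entropy p (fun ω => (ω.2.2.1, ω.2.2.2.1)))) / N ≤ δ := hleak
  have heq' : Δ ≤ (entropy p (fun ω => (ω.2.2.1, ω.2.2.2.1)) -
      entropy p (fun ω => ω.2.2.2.1)) / N := heq
  have hagree' : 1 - δ ≤ prob p (fun ω => decide (ω.2.2.2.2.1 = ω.2.2.2.2.2)) true := hagree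
  rw [hrate] at hunif
  rw [hrate]
  -- At blocklength n, U is Alice's key and V is the transcript.
  obtain ⟨w, hw, hV, hUV⟩ := exists_singleLetter_kernel (sum_receiverLaw_matrix Q J)
    (fun s z => Q.2.1 _) (fun s j => (receiverLaw Q J).2.1 _) (by
      rw [← Q.2.2]
      simp only [Fintype.sum_prod_type, lawMatrix]) c.keyKernel c.isKernel_keyKernel
  obtain ⟨k, hk1, hk2⟩ := exists_small_channel Q J hw
  simp only [Finset.sum_sub_distrib, ← entropy_eve, ← entropy_key_eve, ← hp, ← hp', ← hNm]
    at hV hUV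
  refine ⟨auxOfChannel k, ?_, le_trans ?_ hk2⟩
  -- H(J^n,F) - H(Z^n,F) ≤ H(J^n) + H(F) - H(Z^n,F) = n H(J) - H(Z^n|F), where F has the same law
  -- under both sources.
  · rw [feasible_iff]
    refine hk1.trans ?_
    have hT := c.entropy_letters (receiverLaw Q J) (fun ω => ω.2.2)
    have hpair := entropy_pair_le p0 p1 (fun ω => ω.2.2.1) (fun ω => ω.2.2.2.1)
    have hF : entropy p' (fun ω => ω.2.2.2.1) = entropy p (fun ω => ω.2.2.2.1) := by
      have h1 := entropy_comp p' (fun ω => (ω.1, ω.2.1, ω.2.2.2)) (fun x => x.2.2.1)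
      have h2 := entropy_comp p (fun ω => (ω.1, ω.2.1, ω.2.2.2)) (fun x => x.2.2.1)
      rw [hp', prob_discussion_receiver, ← hp] at h1
      exact h1.trans h2.symm
    rw [le_div_iff₀ hn'] at heq'
    refine le_of_mul_le_mul_left ?_ hn'
    rw [hV, receiverEntropy]
    simp only [letters] at hT
    have : N * (entropy (receiverLaw Q J).1 (fun ω => ω.2.2) - Δ) =
        entropy p' (fun ω => ω.2.2.1) - Δ * N := by
      rw [mul_sub, ← hT, mul_comm Δ]
    linarith
  -- H(K_A|Z^n,F) equals H(K_A|J^n,F) plus n times the difference of the two gaps, and H(K_A|J^n,F)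
  -- ≤ I(K_A;K_B|J^n,F) + H(K_A|K_B).
  · have hinfo : _ ≤ N * receiverInfo Q J := c.condMutualInfo_keys (receiverLaw Q J)
    have hsub := entropy_submodular p0 p1 (fun ω => ω.2.2.2.2.1)
      (fun ω => (ω.2.2.1, ω.2.2.2.1)) (fun ω => ω.2.2.2.2.2)
    have hfano := fano p0 p1 (fun ω => ω.2.2.2.2.1) (fun ω => ω.2.2.2.2.2)
    have r1 := entropy_comp_injective p'
      (fun ω => (ω.2.2.2.2.1, (ω.2.2.1, ω.2.2.2.1), ω.2.2.2.2.2))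
      (g := fun x => (x.1, x.2.2, x.2.1)) (by
        rintro ⟨a, b, c⟩ ⟨a', b', c'⟩ h
        simp only [Prod.mk.injEq] at h ⊢
        tauto)
    have r2 := entropy_comp_injective p' (fun ω => (ω.2.2.2.2.2, (ω.2.2.1, ω.2.2.2.1)))
      Prod.swap_injective
    have hag : prob p' (fun ω => decide (ω.2.2.2.2.1 = ω.2.2.2.2.2)) true =
        prob p (fun ω => decide (ω.2.2.2.2.1 = ω.2.2.2.2.2)) true := by
      have h1 := prob_comp p' (fun ω => (ω.1, ω.2.1, ω.2.2.2))
        (fun x => decide (x.2.2.2.1 = x.2.2.2.2)) true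
      have h2 := prob_comp p (fun ω => (ω.1, ω.2.1, ω.2.2.2))
        (fun x => decide (x.2.2.2.1 = x.2.2.2.2)) true
      rw [hp', prob_discussion_receiver, ← hp] at h1
      exact h1.trans h2.symm
    rw [hag] at hfano
    have hlogK : 0 ≤ Real.log c.keys := Real.log_natCast_nonneg _
    have hfano2 : (1 - prob p (fun ω => decide (ω.2.2.2.2.1 = ω.2.2.2.2.2)) true) *
        Real.log c.keys ≤ δ * Real.log c.keys :=
      mul_le_mul_of_nonneg_right (by linarith) hlogK
    -- Near-uniformity turns the Fano loss δ log|𝒦| into δ H(K_A) + δ² n, whence the factor 1 - δ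
    -- and the δ² in the bound.
    have hK : Real.log c.keys ≤ entropy p (fun ω => ω.2.2.2.2.1) + δ * N := by
      rw [sub_le_iff_le_add, div_add' _ _ _ hn'.ne', div_le_div_iff_of_pos_right hn'] at hunif
      exact hunif
    have hK2 := mul_le_mul_of_nonneg_left hK hδ
    rw [div_le_iff₀ hn'] at hleak'
    simp only [condMutualInfo, condEntropy, Prod.swap] at hinfo hfano r1 r2 hsub
    refine le_of_mul_le_mul_left ?_ hn'
    have hl : N * ((1 - δ) * (entropy p (fun ω => ω.2.2.2.2.1) / N) - δ - δ ^ 2 -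
        Real.log 2 / N) = (1 - δ) * entropy p (fun ω => ω.2.2.2.2.1) - δ * N - δ ^ 2 * N -
          Real.log 2 := by
      field_simp
    rw [hl, mul_sub, mul_add, hV, hUV]
    linarith

end Converse

end Protocol

/-! ### Passage to the limit -/

lemma exists_auxiliary_of_achievable {𝒳 𝒴 𝒵 : Type*} [Fintype 𝒳] [Fintype 𝒴] [Fintype 𝒵]
    (P : Law (𝒳 × 𝒴 × 𝒵)) (J : Receiver 𝒳 𝒴 𝒵) {Δ R : ℝ} (h : Achievable P Δ R) {ε : ℝ}
    (hε : 0 < ε) :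
    ∃ W : Auxiliary 𝒳 𝒴, Feasible P (Δ - ε) J W ∧ R - ε ≤ objective P J W := by
  have hR := abs_nonneg R
  -- Since (1 - δ)(R - δ) - δ - δ² = R - δ(2 + R), this δ costs at most ε/2; the blocklength is
  -- taken large enough for log 2 / n to cost the other half.
  set δ : ℝ := min (min ε 1) (ε / (2 * (2 + |R|))) with hδ
  have hδ0 : 0 < δ := by positivity
  have hδε : δ ≤ ε := (min_le_left _ _).trans (min_le_left _ _)
  have hδ1 : δ ≤ 1 := (min_le_left _ _).trans (min_le_right _ _)
  have hδR : δ * (2 * (2 + |R|)) ≤ ε := by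
    rw [← le_div_iff₀ (by positivity)]
    exact min_le_right _ _
  obtain ⟨N, hN⟩ := exists_nat_ge (2 * Real.log 2 / ε)
  obtain ⟨n, hNn, hn, c, hcode, hrate, heq⟩ := h δ hδ0 N
  obtain ⟨W, hW1, hW2⟩ := c.exists_auxiliary P J hn hδ0.le hcode heq
  refine ⟨W, hW1.mono (by linarith), le_trans ?_ hW2⟩
  have hn' : (0 : ℝ) < n := by exact_mod_cast hn
  have hlog : Real.log 2 / n ≤ ε / 2 := by
    rw [div_le_iff₀ hn']
    rw [div_le_iff₀ hε] at hN
    have : (N : ℝ) * ε ≤ n * ε := mul_le_mul_of_nonneg_right (by exact_mod_cast hNn) hε.le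
    linarith
  have h1 := mul_le_mul_of_nonneg_left hrate (sub_nonneg.2 hδ1)
  have h2 := mul_le_mul_of_nonneg_left (le_abs_self R) hδ0.le
  nlinarith

lemma keyCapacity_le_psi {𝒳 𝒴 𝒵 : Type*} [Fintype 𝒳] [Fintype 𝒴] [Fintype 𝒵]
    (P : Law (𝒳 × 𝒴 × 𝒵)) (Δ : ℝ) : keyCapacity P Δ ≤ psi P Δ := by
  refine iSup₂_le fun R hR => le_iInf fun J => ?_
  obtain ⟨W, h1, h2, h3⟩ := exists_limit_auxiliary P J Δ R
    fun ε hε => exists_auxiliary_of_achievable P J hR hε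
  exact le_iSup₂_of_le W ⟨h1, h2⟩ (by exact_mod_cast h3)

end KeyAgreement

theorem mainTheorem6 {𝒳 𝒴 𝒵 : Type*} [Fintype 𝒳] [Fintype 𝒴] [Fintype 𝒵]
    (P : KeyAgreement.Law (𝒳 × 𝒴 × 𝒵)) (Δ : ℝ) :
    -- the upper bound
    KeyAgreement.keyCapacity P Δ ≤ KeyAgreement.psi P Δ ∧
    -- for each `J`, the inner maximum is attained (unless there is no feasible pair), and the
    -- cardinality bounds do not change it
    (∀ J : KeyAgreement.Receiver 𝒳 𝒴 𝒵,
      (∃ W : KeyAgreement.Auxiliary 𝒳 𝒴, KeyAgreement.Feasible P Δ J W) →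
      ∃ W : KeyAgreement.Auxiliary 𝒳 𝒴,
        KeyAgreement.Feasible P Δ J W ∧ KeyAgreement.CardBounded W ∧
        ∀ W' : KeyAgreement.Auxiliary 𝒳 𝒴, KeyAgreement.Feasible P Δ J W' →
          KeyAgreement.objective P J W' ≤ KeyAgreement.objective P J W) ∧
    -- if `Z = f(X,Y)`, the maximizer can be taken with `H(X,Y|U,V,Z) = 0`
    (∀ f : 𝒳 → 𝒴 → 𝒵, (∀ x y z, P.1 (x, y, z) ≠ 0 → z = f x y) →
      KeyAgreement.psiDetermined P Δ = KeyAgreement.psi P Δ ∧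
      ∀ J : KeyAgreement.Receiver 𝒳 𝒴 𝒵,
        (∃ W : KeyAgreement.Auxiliary 𝒳 𝒴, KeyAgreement.Feasible P Δ J W) →
        ∃ W : KeyAgreement.Auxiliary 𝒳 𝒴,
          KeyAgreement.Feasible P Δ J W ∧ KeyAgreement.CardBounded W ∧
          KeyAgreement.Determined P J W ∧
          ∀ W' : KeyAgreement.Auxiliary 𝒳 𝒴, KeyAgreement.Feasible P Δ J W' →
            KeyAgreement.objective P J W' ≤ KeyAgreement.objective P J W) := by
  refine ⟨KeyAgreement.keyCapacity_le_psi P Δ,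
    fun J hJ => KeyAgreement.exists_maximizer P J Δ hJ, fun f hf =>
      ⟨KeyAgreement.psiDetermined_eq_psi P Δ f hf, fun J hJ => ?_⟩⟩
  obtain ⟨W, h1, -, h3⟩ := KeyAgreement.exists_maximizer P J Δ hJ
  obtain ⟨W', d1, d2, d3, d4⟩ := KeyAgreement.exists_determined P J W Δ f hf h1
  exact ⟨W', d1, d2, d3, fun W'' hW'' => (h3 W'' hW'').trans d4⟩
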